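/- A vector configuration $V$ is a finite family (multiset) of vectors in a real vector space; repetitions and the zero vector are allowed. For an oriented linear hyperplane $H$ let $H^+$ and $H^-$ be its open positive and negative sides and $\overline{H}^-$ its closed negative side. (Besides proper hyperplanes we admit the degenerate choice given by the zero functional, with $H^+=\emptyset$ and $\overline{H}^-$ the whole space; this matters only in dimension $0$.) The dual codegree of $V$ is $\operatorname{codeg}^*(V)=\min_H|\overline{H}^-\cap V|$; the dual degree of $V$ is $\deg^*(V)=\max_H|H^+\cap V|-\operatorname{rank}(V)$; and the covector discrepancy is $\operatorname{Disc}(V)=\max_{C}\bigl||C^+|-|C^-|\bigr|$, the maximum being over all signed covectors $C$ of $V$, i.e. over all sign vectors $(\operatorname{sign} f(v))_{v\in V}$ with $f$ a linear functional. A codegree$^*$ decomposition of $V$ of length $m\ge 0$ is a partition $V=V_0\uplus V_1\uplus\dots\uplus V_m$ ($V_0$ may be empty) such that $\operatorname{codeg}^*(V)=\sum_{i=1}^m\operatorname{codeg}^*(V_i)$ and $\operatorname{codeg}^*(V_i)\ge 1$ for $1\le i\le m$. **Corollary.** Let $V$ be a vector configuration of rank $r$ in $\mathbb{R}^r$ with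 $n=r+d+1$ elements and dual degree $\delta=\deg^*(V)$, and let $k$ be the number of elements of $V$ equal to $\mathbf 0$. If $r\le 4$, then $$d+1-2\delta \;=\; r-\operatorname{Disc}(V)+k,$$ and $V$ admits a codegree$^*$ decomposition of length at least $d+1-2\delta$, hence of length at least $r-\operatorname{Disc}(V)$. In particular, if $V$ is irreducible (that is, $k=0$), then $V$ admits a codegree$^*$ decomposition of length at least $r-\operatorname{Disc}(V)=d+1-2\delta$. -/

import Mathlib

open Finset

noncomputable section

/-!
A vector configuration is a finite family `v : ι → E` of vectors of a real vector space
(repetitions and the zero vector are allowed); a subconfiguration is given by a finite set `S` of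
indices.  An oriented linear hyperplane `H` is given by a linear functional `f`:
`H = {f = 0}`, `H⁺ = {0 < f}`, and the closed negative side is `{f ≤ 0}`.  The functional
`f = 0` is allowed: it has an empty positive side, so it never changes the minimum
or the maxima below, except that it makes them meaningful in the space of dimension zero.
-/

namespace VectorConfig

variable {ι E : Type*} [AddCommGroup E] [Module ℝ E]

/-- The rank of a vector configuration: the dimension of its linear span. -/
def rank (v : ι → E) : ℕ :=
  Module.finrank ℝ (Submodule.span ℝ (Set.range v))

/-- The dual codegree `codeg*` of the subconfiguration indexed by `S`: the minimum, over all
oriented linear hyperplanes, of the number of elements in the closed negative side. -/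
def dualCodegree (v : ι → E) (S : Finset ι) : ℕ :=
  sInf (Set.range fun f : Module.Dual ℝ E => #{i ∈ S | f (v i) ≤ 0})

/-- The dual degree `deg*`: the maximum, over all oriented linear hyperplanes, of the
number of elements in the open positive side, minus the rank. -/
def dualDegree [Fintype ι] (v : ι → E) : ℤ :=
  ((sSup (Set.range fun f : Module.Dual ℝ E => #{i | 0 < f (v i)}) : ℕ) : ℤ) - (rank v : ℤ)

/-- The (signed) covectors of a vector configuration. -/
def covectors (v : ι → E) : Set (ι → SignType) :=
  Set.range fun (f : Module.Dual ℝ E) (i : ι) => SignType.sign (f (v i))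

/-- The covector discrepancy `Disc`: the maximum of `||C⁺| - |C⁻||` over all covectors `C`. -/
def disc [Fintype ι] (v : ι → E) : ℕ :=
  sSup ((fun C : ι → SignType =>
    ((#{i | C i = 1} : ℤ) - (#{i | C i = -1} : ℤ)).natAbs) '' covectors v)

/-- The subconfigurations `P 0, P 1, …, P m` form a codegree* decomposition of length `m`:
they partition the configuration (as indexed elements), the factors `P 1, …, P m` have dual
codegree at least one, and their dual codegrees add up to that of the configuration. -/
structure IsCodegreeStarDecomposition [Fintype ι] [DecidableEq ι] (v : ι → E) (m : ℕ)
    (P : Fin (m + 1) → Finset ι) : Prop where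
  disjoint : ∀ i j, i ≠ j → Disjoint (P i) (P j)
  cover : Finset.univ.biUnion P = Finset.univ
  sum_eq : dualCodegree v Finset.univ = ∑ i : Fin m, dualCodegree v (P i.succ)
  one_le : ∀ i : Fin m, 1 ≤ dualCodegree v (P i.succ)

end VectorConfig

end

/-! Let `c` be the dual codegree, and let the sign sum of a functional be its number of positive
minus its number of negative elements. For a generic functional the closed negative side consists of
the negative elements and the `k` zero vectors, so `Disc + 2c = n + k` (`disc_add`). Since `deg* = n
- c - r`, both sides of the identity equal `r - n + 2c`, and a decomposition of at least this length
is needed.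

Zero vectors and antipodal pairs are split off one by one as factors of positive codegree
(`exists_packing`). In a reduced configuration all sign sums are at most `D = n - 2c` in absolute
value, and the required length is `rank - D`. As the rank is at most 4, length 0 or 1 suffices
unless `D ≤ 2`. If `D = 1`, the rank is at most 2 (`SignBound.mem_span_pair`). If `D = 2` and the
rank is 4, the configuration consists of two disjoint projective lines with an odd number of
elements each (`DiscTwo.exists_split`), and these are the two factors.

The geometry rests on two facts. By perturbation, a flat of odd size in an even configuration with
`D = 2` has bound 1 (`SignBound.restrict_of_odd`). By an extremal argument, two elements all of
whose other lines are alternating have no other lines (`mem_span_pair_of_alternating`). Both are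
applied to the even and odd lines inside the planes of the configuration. -/

namespace VectorConfig

variable {ι E : Type*} [AddCommGroup E] [Module ℝ E]

/-! ### Sign sums, perturbation and restriction to flats -/

/-- The sign of a real number, as an integer. -/
noncomputable def sgn (x : ℝ) : ℤ := ((SignType.sign x : SignType) : ℤ)

lemma sgn_of_pos {x : ℝ} (h : 0 < x) : sgn x = 1 := by simp [sgn, sign_pos h]
lemma sgn_of_neg {x : ℝ} (h : x < 0) : sgn x = -1 := by simp [sgn, sign_neg h]
@[simp] lemma sgn_zero : sgn 0 = 0 := by simp [sgn]

lemma sgn_neg (x : ℝ) : sgn (-x) = -sgn x := by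
  rcases lt_trichotomy x 0 with h | h | h
  · rw [sgn_of_neg h, sgn_of_pos (by linarith)]; rfl
  · simp [h]
  · rw [sgn_of_pos h, sgn_of_neg (by linarith)]

lemma sgn_pos_mul {c : ℝ} (hc : 0 < c) (x : ℝ) : sgn (c * x) = sgn x := by
  rcases lt_trichotomy x 0 with h | h | h
  · rw [sgn_of_neg h, sgn_of_neg (by nlinarith)]
  · simp [h]
  · rw [sgn_of_pos h, sgn_of_pos (by positivity)]

lemma odd_sgn {x : ℝ} (h : x ≠ 0) : Odd (sgn x) := by
  rcases lt_or_gt_of_ne h with h | h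
  · rw [sgn_of_neg h]; decide
  · rw [sgn_of_pos h]; decide

/-- The sum of the signs of a linear functional on a subconfiguration. -/
noncomputable def signSum (v : ι → E) (S : Finset ι) (f : Module.Dual ℝ E) : ℤ :=
  ∑ i ∈ S, sgn (f (v i))

open Classical in
/-- The elements of a subconfiguration that lie in a given subspace. -/
noncomputable def flat (v : ι → E) (S : Finset ι) (W : Submodule ℝ E) : Finset ι :=
  {i ∈ S | v i ∈ W}

/-- A configuration without zero vectors and without antipodal pairs. -/
def Reduced (v : ι → E) (S : Finset ι) : Prop :=
  ∀ i ∈ S, ∀ j ∈ S, ∀ c : ℝ, v j = c • v i → 0 < c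

/-- Every linear functional has sign sum at most `D` in absolute value. -/
def SignBound (v : ι → E) (S : Finset ι) (D : ℤ) : Prop :=
  ∀ f : Module.Dual ℝ E, |signSum v S f| ≤ D

lemma mem_flat {v : ι → E} {S : Finset ι} {W : Submodule ℝ E} {i : ι} :
    i ∈ flat v S W ↔ i ∈ S ∧ v i ∈ W := by
  classical
  simp [flat]

lemma flat_subset (v : ι → E) (S : Finset ι) (W : Submodule ℝ E) : flat v S W ⊆ S :=
  fun _ h => (mem_flat.1 h).1

lemma Reduced.mono {v : ι → E} {S T : Finset ι} (h : Reduced v S) (hT : T ⊆ S) : Reduced v T :=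
  fun i hi j hj => h i (hT hi) j (hT hj)

lemma Reduced.ne_zero {v : ι → E} {S : Finset ι} (h : Reduced v S) {i : ι} (hi : i ∈ S) :
    v i ≠ 0 := fun h0 => lt_irrefl _ (h i hi i hi 0 (by simp [h0]))

lemma flat_flat {v : ι → E} {S : Finset ι} {W W' : Submodule ℝ E} (h : W ≤ W') :
    flat v (flat v S W') W = flat v S W := by
  ext i; simp only [mem_flat]; exact ⟨fun a => ⟨a.1.1, a.2⟩, fun a => ⟨⟨a.1, h a.2⟩, a.2⟩⟩

@[simp] lemma signSum_neg (v : ι → E) (S : Finset ι) (f : Module.Dual ℝ E) :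
    signSum v S (-f) = -signSum v S f := by
  simp [signSum, sgn_neg]

lemma even_signSum_iff {v : ι → E} {S : Finset ι} {f : Module.Dual ℝ E}
    (h : ∀ i ∈ S, f (v i) ≠ 0) : Even (signSum v S f) ↔ Even #S := by
  classical
  induction S using Finset.induction_on with
  | empty => simp [signSum]
  | insert a s ha ih =>
    have h1 := odd_sgn (h a (by simp))
    have h2 := ih (fun i hi => h i (by simp [hi]))
    rw [signSum, Finset.sum_insert ha, card_insert_of_notMem ha, ← signSum]
    rw [Int.even_add, h2, Nat.even_add_one, ← Int.not_odd_iff_even]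
    simp [h1]

/-- A small perturbation of `f` in the direction of `g`. -/
lemma exists_perturb (v : ι → E) (S : Finset ι) (f g : Module.Dual ℝ E) :
    ∃ h : Module.Dual ℝ E, (∀ x, f x = 0 → g x = 0 → h x = 0) ∧
      (∀ i ∈ S, f (v i) ≠ 0 → sgn (h (v i)) = sgn (f (v i))) ∧
      (∀ i ∈ S, f (v i) = 0 → sgn (h (v i)) = sgn (g (v i))) := by
  have key : ∀ i ∈ S, ∀ᶠ ε : ℝ in nhdsWithin 0 (Set.Ioi 0), f (v i) ≠ 0 →
      sgn ((f + ε • g) (v i)) = sgn (f (v i)) := by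
    intro i _
    have hc : Filter.Tendsto (fun ε : ℝ => f (v i) + ε * g (v i)) (nhdsWithin 0 (Set.Ioi 0))
        (nhds (f (v i))) := by
      have : Continuous (fun ε : ℝ => f (v i) + ε * g (v i)) := by fun_prop
      simpa using (this.tendsto 0).mono_left nhdsWithin_le_nhds
    rcases lt_trichotomy (f (v i)) 0 with h | h | h
    · filter_upwards [hc.eventually (gt_mem_nhds h)] with ε hε _
      rw [sgn_of_neg h, sgn_of_neg (by simpa using hε)]
    · exact Filter.Eventually.of_forall fun ε h' => absurd h h'
    · filter_upwards [hc.eventually (lt_mem_nhds h)] with ε hε _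
      rw [sgn_of_pos h, sgn_of_pos (by simpa using hε)]
  have key2 := (Filter.eventually_all_finset S).2 key
  obtain ⟨ε, h1, h2⟩ := (key2.and self_mem_nhdsWithin).exists
  refine ⟨f + ε • g, fun x hx hy => by simp [hx, hy], h1, fun i _ h0 => ?_⟩
  simpa [h0] using sgn_pos_mul h2 (g (v i))

/-- The sign sum of a perturbation of `f` is obtained by adding the sign sum of the perturbing
functional over the kernel of `f`. -/
lemma exists_signSum_add (v : ι → E) (S : Finset ι) (f g : Module.Dual ℝ E) :
    ∃ h : Module.Dual ℝ E, (∀ x, f x = 0 → g x = 0 → h x = 0) ∧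
      (∀ i ∈ S, f (v i) ≠ 0 ∨ g (v i) ≠ 0 → h (v i) ≠ 0) ∧
      ∀ A ⊆ S, signSum v A h = signSum v A f + signSum v {i ∈ A | f (v i) = 0} g := by
  obtain ⟨h, h0, h1, h2⟩ := exists_perturb v S f g
  refine ⟨h, h0, ?_, ?_⟩
  · intro i hi hne hz
    by_cases hf : f (v i) = 0
    · have := h2 i hi hf
      rw [hz, sgn_zero] at this
      have h3 := odd_sgn (hne.resolve_left (not_not.2 hf))
      rw [← this] at h3; exact absurd h3 (by decide)
    · have := h1 i hi hf
      rw [hz, sgn_zero] at this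
      have h3 := odd_sgn hf
      rw [← this] at h3; exact absurd h3 (by decide)
  · intro A hA
    rw [signSum, signSum, signSum, Finset.sum_filter, ← Finset.sum_add_distrib]
    refine Finset.sum_congr rfl fun i hi => ?_
    replace hi := hA hi
    by_cases hf : f (v i) = 0
    · simp [hf, h2 i hi hf]
    · simp [hf, h1 i hi hf]

/-- Perturbing `f` by `g` and by `-g` adds and subtracts the same amount; one of the two choices
makes the absolute values add up. -/
lemma SignBound.add_le {v : ι → E} {S : Finset ι} {D : ℤ} (hD : SignBound v S D)
    (f g : Module.Dual ℝ E) :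
    |signSum v S f| + |signSum v {i ∈ S | f (v i) = 0} g| ≤ D := by
  obtain ⟨h, -, -, h1⟩ := exists_signSum_add v S f g
  obtain ⟨h', -, -, h2⟩ := exists_signSum_add v S f (-g)
  have a := abs_le.1 (hD h)
  have b := abs_le.1 (hD h')
  replace h1 := h1 S subset_rfl
  replace h2 := h2 S subset_rfl
  rw [h1] at a
  rw [h2, signSum_neg] at b
  rcases abs_cases (signSum v S f) with ⟨e1, _⟩ | ⟨e1, _⟩ <;>
  rcases abs_cases (signSum v {i ∈ S | f (v i) = 0} g) with ⟨e2, _⟩ | ⟨e2, _⟩ <;>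
  rw [e1, e2] <;> omega

/-- A functional that vanishes on `W` and on no element of the configuration outside `W`. -/
lemma exists_exact (v : ι → E) (S : Finset ι) (W : Submodule ℝ E) :
    ∃ f : Module.Dual ℝ E, (∀ w ∈ W, f w = 0) ∧ ∀ i ∈ S, v i ∉ W → f (v i) ≠ 0 := by
  obtain ⟨f, hf⟩ := Module.exists_dual_forall_apply_ne_zero (K := ℝ)
    (fun i : {i : S // v i ∉ W} => W.mkQ (v i))
    (fun i => by simpa using i.2)
  refine ⟨f.comp W.mkQ, fun w hw => ?_, fun i hi hW => hf ⟨⟨i, hi⟩, hW⟩⟩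
  simp [(Submodule.Quotient.mk_eq_zero W).2 hw]

lemma exists_exact_flat (v : ι → E) (S : Finset ι) (W : Submodule ℝ E) :
    ∃ f : Module.Dual ℝ E, (∀ w ∈ W, f w = 0) ∧ (∀ i ∈ S, v i ∉ W → f (v i) ≠ 0) ∧
      ({i ∈ S | f (v i) = 0} : Finset ι) = flat v S W := by
  obtain ⟨f, h1, h2⟩ := exists_exact v S W
  refine ⟨f, h1, h2, ?_⟩
  ext i
  simp only [mem_filter, mem_flat]
  exact ⟨fun h => ⟨h.1, by_contra fun hW => h2 i h.1 hW h.2⟩, fun h => ⟨h.1, h1 _ h.2⟩⟩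

lemma SignBound.restrict {v : ι → E} {S : Finset ι} {D : ℤ} (hD : SignBound v S D)
    (W : Submodule ℝ E) : SignBound v (flat v S W) D := by
  obtain ⟨f, -, -, h⟩ := exists_exact_flat v S W
  intro g
  have := hD.add_le f g
  rw [h] at this
  linarith [abs_nonneg (signSum v S f)]

/-- A functional vanishing exactly on the flat has an odd number of nonzero signs, hence a nonzero
sign sum. This uses up at least one of the two units in `SignBound.add_le`. -/
lemma SignBound.restrict_of_odd {v : ι → E} {S : Finset ι} (hD : SignBound v S 2) (hS : Even #S)
    {W : Submodule ℝ E} (hW : Odd #(flat v S W)) : SignBound v (flat v S W) 1 := by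
  classical
  obtain ⟨f, hf, hf', h⟩ := exists_exact_flat v S W
  intro g
  have := hD.add_le f g
  rw [h] at this
  have h1 : signSum v S f = signSum v (S \ flat v S W) f := by
    rw [signSum, ← Finset.sum_sdiff (flat_subset v S W), signSum]
    simp only [add_eq_left]
    exact Finset.sum_eq_zero fun i hi => by rw [hf _ (mem_flat.1 hi).2, sgn_zero]
  have h2 : ¬ Even (signSum v S f) := by
    rw [h1, even_signSum_iff, card_sdiff_of_subset (flat_subset v S W),
      Nat.even_sub (card_le_card (flat_subset v S W))]
    · simp [hS, hW]
    · intro i hi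
      simp only [mem_sdiff, mem_flat, not_and] at hi
      exact hf' i hi.1 (hi.2 hi.1)
  have h3 : signSum v S f ≠ 0 := fun h0 => h2 (by rw [h0]; exact Even.zero)
  have h4 := abs_pos.2 h3
  linarith

lemma exists_dual_eq_one {W : Submodule ℝ E} {x : E} (hx : x ∉ W) :
    ∃ f : Module.Dual ℝ E, (∀ w ∈ W, f w = 0) ∧ f x = 1 := by
  obtain ⟨f, h1, h2⟩ := Submodule.exists_le_ker_of_notMem hx
  exact ⟨(f x)⁻¹ • f, fun w hw => by simp [LinearMap.mem_ker.1 (h2 hw)], by simp [h1]⟩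

lemma mem_span_pair_iff {x y z : E} :
    z ∈ Submodule.span ℝ {x, y} ↔ ∃ a b : ℝ, z = a • x + b • y := by
  rw [Submodule.mem_span_pair]
  exact ⟨fun ⟨a, b, h⟩ => ⟨a, b, h.symm⟩, fun ⟨a, b, h⟩ => ⟨a, b, h.symm⟩⟩

lemma mem_span_singleton_iff {x z : E} :
    z ∈ Submodule.span ℝ {x} ↔ ∃ a : ℝ, z = a • x := by
  rw [Submodule.mem_span_singleton]
  exact ⟨fun ⟨a, h⟩ => ⟨a, h.symm⟩, fun ⟨a, h⟩ => ⟨a, h.symm⟩⟩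

/-- A functional of absolute sign sum at least the number of elements on a given ray. -/
lemma Reduced.exists_le_signSum {v : ι → E} {S : Finset ι} (hS : Reduced v S) {i : ι}
    (hi : i ∈ S) : ∃ f : Module.Dual ℝ E, (∀ j ∈ S, f (v j) ≠ 0) ∧
      (#(flat v S (Submodule.span ℝ {v i})) : ℤ) ≤ |signSum v S f| := by
  obtain ⟨f, h1, h2, h3⟩ := exists_exact_flat v S (Submodule.span ℝ {v i})
  obtain ⟨g, -, hg⟩ := exists_dual_eq_one (W := ⊥) (x := v i) (by simpa using hS.ne_zero hi)
  have hp : ∀ j ∈ S, v j ∈ Submodule.span ℝ {v i} → 0 < g (v j) := by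
    intro j hj hm
    obtain ⟨c, hc⟩ := mem_span_singleton_iff.1 hm
    have := hS i hi j hj c hc
    simpa [hc, hg] using this
  have hs : signSum v (flat v S (Submodule.span ℝ {v i})) g =
      #(flat v S (Submodule.span ℝ {v i})) := by
    rw [signSum, Finset.card_eq_sum_ones, Nat.cast_sum]
    refine Finset.sum_congr rfl fun j hj => ?_
    rw [mem_flat] at hj
    simp [sgn_of_pos (hp j hj.1 hj.2)]
  obtain ⟨h, -, a1, a2⟩ := exists_signSum_add v S f g
  obtain ⟨h', -, b1, b2⟩ := exists_signSum_add v S f (-g)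
  replace a2 := a2 S subset_rfl
  replace b2 := b2 S subset_rfl
  rw [h3, hs] at a2
  rw [h3, signSum_neg, hs] at b2
  have hne : ∀ j ∈ S, f (v j) ≠ 0 ∨ g (v j) ≠ 0 := fun j hj => by
    by_cases hm : v j ∈ Submodule.span ℝ {v i}
    · exact Or.inr (hp j hj hm).ne'
    · exact Or.inl (h2 j hj hm)
  -- The elements on the ray all lie on one side of `g`. The sign of the perturbation is chosen so
  -- that they reinforce the sign sum of `f`.
  by_cases hpos : 0 ≤ signSum v S f
  · refine ⟨h, fun j hj => a1 j hj (hne j hj), ?_⟩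
    rw [a2, abs_of_nonneg (by positivity)]; linarith
  · refine ⟨h', fun j hj => b1 j hj (by simpa using hne j hj), ?_⟩
    rw [b2, abs_of_neg (by omega)]; omega

lemma card_ray_pos {v : ι → E} {S : Finset ι} {i : ι} (hi : i ∈ S) :
    0 < #(flat v S (Submodule.span ℝ {v i})) :=
  card_pos.2 ⟨i, mem_flat.2 ⟨hi, Submodule.mem_span_singleton_self _⟩⟩

lemma signBound_add_ray {v : ι → E} {S : Finset ι} {D : ℤ} (hS : Reduced v S)
    (hD : SignBound v S D) {i : ι} (hi : i ∈ S) {f : Module.Dual ℝ E} (hf : f (v i) = 0) :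
    |signSum v S f| + #(flat v S (Submodule.span ℝ {v i})) ≤ D := by
  obtain ⟨g, -, hg⟩ := (hS.mono (filter_subset (fun j => f (v j) = 0) S)).exists_le_signSum
    (i := i) (by simp [hi, hf])
  have h1 := hD.add_le f g
  have h2 : flat v {j ∈ S | f (v j) = 0} (Submodule.span ℝ {v i}) =
      flat v S (Submodule.span ℝ {v i}) := by
    ext j
    simp only [mem_flat, mem_filter]
    refine ⟨fun h => ⟨h.1.1, h.2⟩, fun h => ⟨⟨h.1, ?_⟩, h.2⟩⟩
    obtain ⟨c, hc⟩ := mem_span_singleton_iff.1 h.2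
    simp [hc, hf]
  rw [h2] at hg
  linarith

lemma span_singleton_le_pair_left (x y : E) :
    Submodule.span ℝ {x} ≤ Submodule.span ℝ {x, y} :=
  Submodule.span_mono (by simp)

lemma mem_pair_left (x y : E) : x ∈ Submodule.span ℝ {x, y} := Submodule.subset_span (by simp)

lemma mem_pair_right (x y : E) : y ∈ Submodule.span ℝ {x, y} := Submodule.subset_span (by simp)

/-! ### Alternating lines and the extremal argument -/

/-- The elements of `A` on the line through `v x` and `v y` of the projective configuration are
balanced with respect to `v x`, and their sign sums are smaller than the number of elements on the
two rays spanned by `v x` and `v y`. -/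
structure Alternating (v : ι → E) (A : Finset ι) (x y : ι) : Prop where
  balanced : ∀ f : Module.Dual ℝ E, f (v x) = 0 →
    signSum v (flat v A (Submodule.span ℝ {v x, v y})) f = 0
  lt : ∀ f : Module.Dual ℝ E, |signSum v (flat v A (Submodule.span ℝ {v x, v y})) f| <
    #(flat v A (Submodule.span ℝ {v x})) + #(flat v A (Submodule.span ℝ {v y}))

/-- A functional vanishing at `x` leaves room for the nonempty ray of `x` by `signBound_add_ray`, so
its sign sum is 0. The strict inequality is `1 < 1 + 1`. -/
lemma Alternating.of_signBound_one {v : ι → E} {A : Finset ι} {x y : ι} (hA : Reduced v A)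
    (hx : x ∈ A) (hy : y ∈ A)
    (h : SignBound v (flat v A (Submodule.span ℝ {v x, v y})) 1) : Alternating v A x y := by
  constructor
  · intro f hf
    have hx' : x ∈ flat v A (Submodule.span ℝ {v x, v y}) := mem_flat.2 ⟨hx, mem_pair_left _ _⟩
    have h1 := signBound_add_ray (hA.mono (flat_subset _ _ _)) h hx' (f := f) hf
    have h2 := card_ray_pos (v := v) hx'
    exact abs_eq_zero.1 (le_antisymm (by omega) (abs_nonneg _))
  · intro f
    have h1 := h f
    have h2 := card_ray_pos (v := v) hx
    have h3 := card_ray_pos (v := v) hy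
    omega

/-- On the line, the signs of `q` are those of `-p` except on the two rays. Since `p` is balanced,
the sign sum of `q` is the size of the ray of `x` plus or minus that of `y`, with the sign of `p (v
y)`. The plus sign contradicts `Alternating.lt`. -/
lemma Alternating.apply_neg {v : ι → E} {A : Finset ι} {x y : ι} (hA : Reduced v A)
    (h : Alternating v A x y) (hx : x ∈ A) (hy : y ∈ A) (p q : Module.Dual ℝ E)
    (px : p (v x) = 0) (py : p (v y) ≠ 0) (qx : 0 < q (v x)) (qy : q (v y) = 0)
    (hpq : ∀ z ∈ A, v z ∈ Submodule.span ℝ {v x, v y} → v z ∉ Submodule.span ℝ {v x} →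
      v z ∉ Submodule.span ℝ {v y} → sgn (q (v z)) = -sgn (p (v z))) : p (v y) < 0 := by
  classical
  set O := flat v A (Submodule.span ℝ {v x, v y}) with hO
  have key : ∀ z ∈ O, sgn (q (v z)) = (if v z ∈ Submodule.span ℝ {v x} then 1 else 0) +
      (if v z ∈ Submodule.span ℝ {v y} then 1 else 0) * sgn (p (v y)) - sgn (p (v z)) := by
    intro z hz
    rw [hO, mem_flat] at hz
    by_cases h1 : v z ∈ Submodule.span ℝ {v x}
    · obtain ⟨c, hc⟩ := mem_span_singleton_iff.1 h1
      have hc0 := hA x hx z hz.1 c hc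
      have h2 : v z ∉ Submodule.span ℝ {v y} := by
        intro h2
        obtain ⟨d, hd⟩ := mem_span_singleton_iff.1 h2
        have : q (v z) = 0 := by simp [hd, qy]
        rw [hc] at this
        simp [hc0.ne', qx.ne'] at this
      have h3 : 0 < q (v z) := by rw [hc]; simpa using mul_pos hc0 qx
      have h4 : p (v z) = 0 := by rw [hc]; simp [px]
      simp [h1, h2, sgn_of_pos h3, h4]
    · by_cases h2 : v z ∈ Submodule.span ℝ {v y}
      · obtain ⟨c, hc⟩ := mem_span_singleton_iff.1 h2
        have hc0 := hA y hy z hz.1 c hc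
        have h3 : q (v z) = 0 := by rw [hc]; simp [qy]
        have h4 : sgn (p (v z)) = sgn (p (v y)) := by
          rw [hc, map_smul, smul_eq_mul, sgn_pos_mul hc0]
        simp [h1, h2, h3, h4]
      · simp [h1, h2, hpq z hz.1 hz.2 h1 h2]
  have hcard : ∀ w, v w ∈ Submodule.span ℝ {v x, v y} →
      (∑ z ∈ O, if v z ∈ Submodule.span ℝ {v w} then (1 : ℤ) else 0) =
        #(flat v A (Submodule.span ℝ {v w})) := by
    intro w hw
    rw [← flat_flat ((Submodule.span_singleton_le_iff_mem _ _).2 hw), ← hO, flat]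
    simp
  have hsum : signSum v O q = #(flat v A (Submodule.span ℝ {v x})) +
      #(flat v A (Submodule.span ℝ {v y})) * sgn (p (v y)) := by
    rw [signSum, Finset.sum_congr rfl key, Finset.sum_sub_distrib, Finset.sum_add_distrib,
      ← Finset.sum_mul, hcard x (mem_pair_left _ _), hcard y (mem_pair_right _ _)]
    have := h.balanced p px
    rw [signSum] at this
    rw [this, sub_zero]
  by_contra hcon
  have hp : 0 < p (v y) := lt_of_le_of_ne (not_lt.1 hcon) (Ne.symm py)
  have h1 := h.lt q
  rw [← hO, hsum, sgn_of_pos hp, abs_of_nonneg (by positivity)] at h1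
  omega

/-- If all lines through `x` and through `x'`, except possibly the line through `x` and `x'`, are
alternating, then there are no such lines. -/
theorem mem_span_pair_of_alternating {v : ι → E} {A : Finset ι} (hA : Reduced v A) {x x' : ι}
    (hx : x ∈ A) (hx' : x' ∈ A) (hne : v x' ∉ Submodule.span ℝ {v x})
    (h : ∀ y ∈ A, v y ∉ Submodule.span ℝ {v x, v x'} → Alternating v A x y)
    (h' : ∀ y ∈ A, v y ∉ Submodule.span ℝ {v x, v x'} → Alternating v A x' y)
    {y : ι} (hy : y ∈ A) : v y ∈ Submodule.span ℝ {v x, v x'} := by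
  classical
  by_contra hy0
  obtain ⟨p, hp, hpA⟩ := exists_exact v A (Submodule.span ℝ {v x, v x'})
  have hpx := hp _ (mem_pair_left _ _)
  have hpx' := hp _ (mem_pair_right _ _)
  obtain ⟨k, hk, hk1⟩ := exists_dual_eq_one hne
  have hkx := hk _ (Submodule.mem_span_singleton_self _)
  have hne' : v x ∉ Submodule.span ℝ {v x'} := by
    intro hm
    obtain ⟨c, hc⟩ := mem_span_singleton_iff.1 hm
    have hc0 := hA x' hx' x hx c hc
    exact hne (mem_span_singleton_iff.2 ⟨c⁻¹, by rw [hc, inv_smul_smul₀ hc0.ne']⟩)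
  obtain ⟨l, hl, hl1⟩ := exists_dual_eq_one hne'
  have hlx' := hl _ (Submodule.mem_span_singleton_self _)
  set M : Finset ι := {z ∈ A | p (v z) ≠ 0} with hM
  -- In the affine chart `p = 1` the elements `x`, `x'` lie at infinity: lines through `x` have
  -- constant `k / p`, lines through `x'` constant `l / p`. Minimising `k / p - l / p` makes `z`
  -- extremal on both of its lines: `l / p` is largest on the one through `x`, `k / p` smallest on
  -- the one through `x'`.
  obtain ⟨z, hz, hmin⟩ := M.exists_min_image
    (fun z => k (v z) / p (v z) + - (l (v z) / p (v z)))
    ⟨y, by simpa [hM] using ⟨hy, hpA y hy hy0⟩⟩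
  simp only [hM, mem_filter] at hz
  obtain ⟨hzA, hpz⟩ := hz
  have hzl : v z ∉ Submodule.span ℝ {v x, v x'} := fun hm => hpz (hp _ hm)
  -- The second functional vanishes at `z`; by extremality its sign is opposite to that of `p` on
  -- the rest of the line.
  have neg := (h z hzA hzl).apply_neg hA hx hzA p (l - (l (v z) / p (v z)) • p) hpx hpz
    (by simp [hl1, hpx]) (by simp [hpz]) (by
      intro w hw hwO hwx hwz
      obtain ⟨a, b, hab⟩ := mem_span_pair_iff.1 hwO
      have hb : b ≠ 0 := fun hb => hwx (mem_span_singleton_iff.2 ⟨a, by simpa [hb] using hab⟩)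
      have ha : a ≠ 0 := fun ha => hwz (mem_span_singleton_iff.2 ⟨b, by simpa [ha] using hab⟩)
      have hpw : p (v w) = b * p (v z) := by simp [hab, hpx]
      have hkw : k (v w) = b * k (v z) := by simp [hab, hkx]
      have hlw : l (v w) = a + b * l (v z) := by simp [hab, hl1]
      have hpw0 : p (v w) ≠ 0 := by rw [hpw]; exact mul_ne_zero hb hpz
      have hm := hmin w (by simp only [hM, mem_filter]; exact ⟨hw, hpw0⟩)
      have hkk : k (v w) / p (v w) = k (v z) / p (v z) := by rw [hkw, hpw]; field_simp
      have hll : (l (v w) / p (v w)) ≤ (l (v z) / p (v z)) := by rw [hkk] at hm; linarith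
      have heq : (l - (l (v z) / p (v z)) • p) (v w) =
          (l (v w) / p (v w) - l (v z) / p (v z)) * p (v w) := by
        simp; field_simp
      have hll' : l (v w) / p (v w) ≠ l (v z) / p (v z) := by
        intro he
        rw [he] at heq
        have : (l - (l (v z) / p (v z)) • p) (v w) = a := by
          simp [hlw, hpw]; field_simp; ring
        rw [this] at heq
        simp at heq
        exact ha heq
      have hlt : l (v w) / p (v w) < l (v z) / p (v z) := lt_of_le_of_ne hll hll'
      rw [heq, ← sgn_neg, ← sgn_pos_mul (sub_pos.2 hlt) (-p (v w))]
      congr 1; ring)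
  -- Here `z` is a minimum instead of a maximum, so `-p` takes the role of `p`, and the opposite
  -- sign of `p (v z)` follows.
  have pos := (h' z hzA hzl).apply_neg hA hx' hzA (-p) (k - (k (v z) / p (v z)) • p)
    (by simp [hpx']) (by simpa using hpz)
    (by simp [hk1, hpx']) (by simp [hpz]) (by
      intro w hw hwO hwx hwz
      obtain ⟨a, b, hab⟩ := mem_span_pair_iff.1 hwO
      have hb : b ≠ 0 := fun hb => hwx (mem_span_singleton_iff.2 ⟨a, by simpa [hb] using hab⟩)
      have ha : a ≠ 0 := fun ha => hwz (mem_span_singleton_iff.2 ⟨b, by simpa [ha] using hab⟩)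
      have hpw : p (v w) = b * p (v z) := by simp [hab, hpx']
      have hlw : l (v w) = b * l (v z) := by simp [hab, hlx']
      have hkw : k (v w) = a + b * k (v z) := by simp [hab, hk1]
      have hpw0 : p (v w) ≠ 0 := by rw [hpw]; exact mul_ne_zero hb hpz
      have hm := hmin w (by simp only [hM, mem_filter]; exact ⟨hw, hpw0⟩)
      have hll : l (v w) / p (v w) = l (v z) / p (v z) := by rw [hlw, hpw]; field_simp
      have hkk : (k (v z) / p (v z)) ≤ (k (v w) / p (v w)) := by rw [hll] at hm; linarith
      have heq : (k - (k (v z) / p (v z)) • p) (v w) =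
          (k (v w) / p (v w) - k (v z) / p (v z)) * p (v w) := by
        simp; field_simp
      have hkk' : k (v z) / p (v z) ≠ k (v w) / p (v w) := by
        intro he
        rw [← he] at heq
        have : (k - (k (v z) / p (v z)) • p) (v w) = a := by
          simp [hkw, hpw]; field_simp; ring
        rw [this] at heq
        simp at heq
        exact ha heq
      have hlt : k (v z) / p (v z) < k (v w) / p (v w) := lt_of_le_of_ne hkk hkk'
      rw [heq, sgn_pos_mul (sub_pos.2 hlt)]
      simp [sgn_neg])
  simp at pos
  linarith

/-- A reduced configuration all of whose sign sums are at most one has rank at most two. -/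
theorem SignBound.mem_span_pair {v : ι → E} {A : Finset ι} (hA : Reduced v A)
    (h : SignBound v A 1) {x x' y : ι} (hx : x ∈ A) (hx' : x' ∈ A) (hy : y ∈ A)
    (hne : v x' ∉ Submodule.span ℝ {v x}) : v y ∈ Submodule.span ℝ {v x, v x'} :=
  mem_span_pair_of_alternating hA hx hx' hne
    (fun _ hy _ => .of_signBound_one hA hx hy (h.restrict _))
    (fun _ hy _ => .of_signBound_one hA hx' hy (h.restrict _)) hy

/-! ### Exchange and dimension of spans -/

lemma span_insert_exchange {s : Set E} {x y : E} (h : x ∈ Submodule.span ℝ (insert y s))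
    (hx : x ∉ Submodule.span ℝ s) :
    Submodule.span ℝ (insert y s) = Submodule.span ℝ (insert x s) := by
  have h' := mem_span_insert_exchange h hx
  apply le_antisymm <;> rw [Submodule.span_le, Set.insert_subset_iff]
  · exact ⟨h', (Set.subset_insert _ _).trans Submodule.subset_span⟩
  · exact ⟨h, (Set.subset_insert _ _).trans Submodule.subset_span⟩

lemma span_pair_eq {x y z : E} (h : z ∈ Submodule.span ℝ {x, y})
    (hz : z ∉ Submodule.span ℝ {x}) : Submodule.span ℝ {x, y} = Submodule.span ℝ {x, z} := by
  rw [Set.pair_comm x y] at h ⊢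
  rw [Set.pair_comm x z]
  exact span_insert_exchange h hz

lemma notMem_span_pair_swap {x y z : E} (hy : y ∉ Submodule.span ℝ {x})
    (hz : z ∉ Submodule.span ℝ {x, y}) : y ∉ Submodule.span ℝ {x, z} := fun h => by
  rw [Set.pair_comm] at h
  apply hz
  rw [Set.pair_comm]
  exact mem_span_insert_exchange h hy

lemma notMem_span_triple_swap {x y z w : E} (hz : z ∉ Submodule.span ℝ {x, y})
    (hw : w ∉ Submodule.span ℝ {x, y, z}) : z ∉ Submodule.span ℝ {x, y, w} := fun h => by
  have e : ∀ u : E, ({x, y, u} : Set E) = insert u {x, y} := fun u => by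
    ext; simp; tauto
  rw [e] at h
  apply hw
  rw [e]
  exact mem_span_insert_exchange h hz

lemma notMem_span_singleton_symm {x y : E} (hx : x ≠ 0) (h : y ∉ Submodule.span ℝ {x}) :
    x ∉ Submodule.span ℝ {y} := fun hm => by
  obtain ⟨c, rfl⟩ := mem_span_singleton_iff.1 hm
  have hc : c ≠ 0 := fun h0 => hx (by simp [h0])
  exact h (mem_span_singleton_iff.2 ⟨c⁻¹, by rw [inv_smul_smul₀ hc]⟩)

lemma span_triple_le {x y z : E} {W : Submodule ℝ E} (hx : x ∈ W) (hy : y ∈ W) (hz : z ∈ W) :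
    Submodule.span ℝ {x, y, z} ≤ W := by
  rw [Submodule.span_le]; rintro _ (rfl | rfl | rfl) <;> assumption

lemma span_pair_le {x y : E} {W : Submodule ℝ E} (hx : x ∈ W) (hy : y ∈ W) :
    Submodule.span ℝ {x, y} ≤ W := by
  rw [Submodule.span_le]; rintro _ (rfl | rfl) <;> assumption

lemma finrank_span_triple {x y z : E} (hx : x ≠ 0) (hy : y ∉ Submodule.span ℝ {x})
    (hz : z ∉ Submodule.span ℝ {x, y}) : Module.finrank ℝ (Submodule.span ℝ {x, y, z}) = 3 := by
  classical
  have f1 := FiniteDimensional.span_of_finite ℝ (Set.toFinite {x, y})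
  have f2 := FiniteDimensional.span_of_finite ℝ (Set.toFinite {x, y, z})
  have h1 := finrank_span_singleton (K := ℝ) hx
  have h2 : Submodule.span ℝ {x} < Submodule.span ℝ {x, y} :=
    lt_of_le_of_ne (span_singleton_le_pair_left x y) fun h => hy (h ▸ mem_pair_right x y)
  have h3 : Submodule.span ℝ {x, y} < Submodule.span ℝ {x, y, z} :=
    lt_of_le_of_ne (span_pair_le (Submodule.subset_span (by simp))
      (Submodule.subset_span (by simp))) fun h => hz (h ▸ Submodule.subset_span (by simp))
  have h4 := Submodule.finrank_lt_finrank_of_lt h2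
  have h5 := Submodule.finrank_lt_finrank_of_lt h3
  have h6 := finrank_span_finset_le_card (R := ℝ) ({x, y, z} : Finset E)
  have h7 : #({x, y, z} : Finset E) ≤ 3 := card_le_three
  rw [Set.finrank] at h6
  rw [show (({x, y, z} : Finset E) : Set E) = {x, y, z} by ext; simp] at h6
  omega

lemma finrank_span_pair_le (x y : E) : Module.finrank ℝ (Submodule.span ℝ {x, y}) ≤ 2 := by
  classical
  have h6 := finrank_span_finset_le_card (R := ℝ) ({x, y} : Finset E)
  have h7 : #({x, y} : Finset E) ≤ 2 := card_le_two
  rw [Set.finrank] at h6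
  rw [show (({x, y} : Finset E) : Set E) = {x, y} by ext; simp] at h6
  omega

/-! ### Even and odd lines when sign sums are at most two -/

/-- The subspace spanned by two elements of a configuration: a line of the projective
configuration. -/
abbrev line (v : ι → E) (i j : ι) : Submodule ℝ E := Submodule.span ℝ {v i, v j}

/-- The subspace spanned by three elements of a configuration. -/
abbrev plane (v : ι → E) (i j k : ι) : Submodule ℝ E := Submodule.span ℝ {v i, v j, v k}

/-- The subspace spanned by one element of a configuration. -/
abbrev ray (v : ι → E) (i : ι) : Submodule ℝ E := Submodule.span ℝ {v i}

lemma line_comm (v : ι → E) (i j : ι) : line v i j = line v j i := by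
  rw [line, Set.pair_comm]

/-- A three-dimensional subspace spanned by elements of the configuration. -/
def IsPlane (v : ι → E) (S : Finset ι) (F : Submodule ℝ E) : Prop :=
  ∃ x ∈ S, ∃ y ∈ S, ∃ z ∈ S, v y ∉ ray v x ∧ v z ∉ line v x y ∧ F = plane v x y z

lemma mem_plane_left (v : ι → E) (i j k : ι) : v i ∈ plane v i j k :=
  Submodule.subset_span (by simp)
lemma mem_plane_mid (v : ι → E) (i j k : ι) : v j ∈ plane v i j k :=
  Submodule.subset_span (by simp)
lemma mem_plane_right (v : ι → E) (i j k : ι) : v k ∈ plane v i j k :=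
  Submodule.subset_span (by simp)

lemma IsPlane.finrank {v : ι → E} {S : Finset ι} (hS : Reduced v S) {F : Submodule ℝ E}
    (hF : IsPlane v S F) : Module.finrank ℝ F = 3 := by
  obtain ⟨x, hx, y, -, z, -, h1, h2, rfl⟩ := hF
  exact finrank_span_triple (hS.ne_zero hx) h1 h2

lemma IsPlane.eq {v : ι → E} {S : Finset ι} (hS : Reduced v S) {F : Submodule ℝ E}
    (hF : IsPlane v S F) {i j k : ι} (hi : i ∈ S) (hiF : v i ∈ F) (hjF : v j ∈ F) (hkF : v k ∈ F)
    (hj : v j ∉ ray v i) (hk : v k ∉ line v i j) : F = plane v i j k := by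
  have h1 := hF.finrank hS
  have : FiniteDimensional ℝ F := FiniteDimensional.of_finrank_pos (by omega)
  exact (Submodule.eq_of_le_of_finrank_le (span_triple_le hiF hjF hkF)
    (by rw [h1, finrank_span_triple (hS.ne_zero hi) hj hk])).symm

lemma IsPlane.exists_notMem_line {v : ι → E} {S : Finset ι} (hS : Reduced v S)
    {F : Submodule ℝ E} (hF : IsPlane v S F) (i j : ι) :
    ∃ k ∈ S, v k ∈ F ∧ v k ∉ line v i j := by
  have h1 := hF.finrank hS
  obtain ⟨x, hx, y, hy, z, hz, -, -, rfl⟩ := hF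
  by_contra! hcon
  have h2 : plane v x y z ≤ line v i j := span_triple_le (hcon x hx (mem_plane_left _ _ _ _))
    (hcon y hy (mem_plane_mid _ _ _ _)) (hcon z hz (mem_plane_right _ _ _ _))
  have f1 := FiniteDimensional.span_of_finite ℝ (Set.toFinite {v i, v j})
  have h3 := Submodule.finrank_mono h2
  have h4 := finrank_span_pair_le (v i) (v j)
  rw [line] at h3
  omega

/-- A reduced configuration of even size and rank at least four, with sign sums at most two. -/
structure DiscTwo (v : ι → E) (S : Finset ι) : Prop where
  red : Reduced v S
  bound : SignBound v S 2
  even : Even #S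
  rank : ∀ x ∈ S, ∀ y ∈ S, ∀ z ∈ S, ∃ a ∈ S, v a ∉ plane v x y z

/-- The line through `i` and `j` contains an even number of elements. -/
def EvenLine (v : ι → E) (S : Finset ι) (i j : ι) : Prop :=
  v j ∉ ray v i ∧ Even #(flat v S (line v i j))

/-- The element `i` is the only one on its ray. -/
def Simple (v : ι → E) (S : Finset ι) (i : ι) : Prop := ∀ j ∈ S, v j ∈ ray v i → j = i

/-- All lines through `i` in `F` contain an even number of elements. -/
def Good (v : ι → E) (S : Finset ι) (i : ι) (F : Submodule ℝ E) : Prop :=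
  ∀ j ∈ S, v j ∈ F → v j ∉ ray v i → EvenLine v S i j

lemma EvenLine.symm {v : ι → E} {S : Finset ι} (hS : Reduced v S) {i j : ι} (hi : i ∈ S)
    (h : EvenLine v S i j) : EvenLine v S j i :=
  ⟨notMem_span_singleton_symm (hS.ne_zero hi) h.1, by rw [line_comm]; exact h.2⟩

lemma EvenLine.congr {v : ι → E} {S : Finset ι} {i j k : ι} (h : EvenLine v S i j)
    (hk : v k ∈ line v i j) (hk' : v k ∉ ray v i) : EvenLine v S i k :=
  ⟨hk', by rw [line, ← span_pair_eq hk hk']; exact h.2⟩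

namespace DiscTwo

variable {v : ι → E} {S : Finset ι}

lemma bound_of_not_evenLine (h : DiscTwo v S) {i j : ι} (hj : v j ∉ ray v i)
    (hn : ¬ EvenLine v S i j) : SignBound v (flat v S (line v i j)) 1 :=
  h.bound.restrict_of_odd h.even (Nat.not_even_iff_odd.1 fun he => hn ⟨hj, he⟩)

lemma card_ray_le_one_of_signBound {A : Finset ι} (hA : Reduced v A) (hb : SignBound v A 1)
    {i : ι} (hi : i ∈ A) : #(flat v A (ray v i)) ≤ 1 := by
  obtain ⟨f, -, hf⟩ := hA.exists_le_signSum hi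
  have := hb f
  rw [ray]
  omega

lemma simple_of_odd (h : DiscTwo v S) {i : ι} (hi : i ∈ S) {W : Submodule ℝ E} (hiW : v i ∈ W)
    (hW : Odd #(flat v S W)) : Simple v S i := by
  have h1 := card_ray_le_one_of_signBound (h.red.mono (flat_subset v S W))
    (h.bound.restrict_of_odd h.even hW) (mem_flat.2 ⟨hi, hiW⟩)
  rw [ray, flat_flat ((Submodule.span_singleton_le_iff_mem _ _).2 hiW)] at h1
  intro j hj hm
  exact Finset.card_le_one.1 h1 j (mem_flat.2 ⟨hj, hm⟩) i
    (mem_flat.2 ⟨hi, Submodule.mem_span_singleton_self _⟩)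

lemma good_of_not_simple (h : DiscTwo v S) {i : ι} (hi : i ∈ S) (hs : ¬ Simple v S i)
    (F : Submodule ℝ E) : Good v S i F := by
  intro j hj _ hji
  by_contra hn
  exact hs (h.simple_of_odd hi (mem_pair_left _ (v j))
    (Nat.not_even_iff_odd.1 fun he => hn ⟨hji, he⟩))

/-- An odd plane would have sign bound 1 and hence rank at most 2. -/
lemma even_plane (h : DiscTwo v S) {F : Submodule ℝ E} (hF : IsPlane v S F) :
    Even #(flat v S F) := by
  by_contra ho
  have hb := h.bound.restrict_of_odd h.even (Nat.not_even_iff_odd.1 ho)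
  obtain ⟨x, hx, y, hy, z, hz, h1, h2, rfl⟩ := hF
  exact h2 (hb.mem_span_pair (h.red.mono (flat_subset _ _ _))
    (mem_flat.2 ⟨hx, mem_plane_left _ _ _ _⟩) (mem_flat.2 ⟨hy, mem_plane_mid _ _ _ _⟩)
    (mem_flat.2 ⟨hz, mem_plane_right _ _ _ _⟩) h1)

/-- The lines through `i` partition the other elements of `F`, which are odd in number. If all these
lines were odd, each would contribute an even number. -/
lemma exists_evenLine (h : DiscTwo v S) {i : ι} (hi : i ∈ S) (hs : Simple v S i)
    {F : Submodule ℝ E} (hF : IsPlane v S F) (hiF : v i ∈ F) :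
    ∃ j ∈ S, v j ∈ F ∧ EvenLine v S i j := by
  classical
  by_contra! hcon
  have he := h.even_plane hF
  have hiF' : i ∈ flat v S F := mem_flat.2 ⟨hi, hiF⟩
  have h1 : Even #((flat v S F).erase i) := by
    rw [Finset.card_eq_sum_card_image (line v i)]
    refine Finset.even_sum _ fun L hL => ?_
    obtain ⟨j, hj, rfl⟩ := Finset.mem_image.1 hL
    rw [Finset.mem_erase, mem_flat] at hj
    have hji : v j ∉ ray v i := fun hm => hj.1 (hs j hj.2.1 hm)
    have ho : Odd #(flat v S (line v i j)) :=
      Nat.not_even_iff_odd.1 fun he => hcon j hj.2.1 hj.2.2 ⟨hji, he⟩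
    have hfib : ({k ∈ (flat v S F).erase i | line v i k = line v i j} : Finset ι) =
        (flat v S (line v i j)).erase i := by
      ext k
      simp only [mem_filter, Finset.mem_erase, mem_flat]
      constructor
      · rintro ⟨⟨a, b, c⟩, d⟩
        exact ⟨a, b, d ▸ mem_pair_right _ _⟩
      · rintro ⟨a, b, c⟩
        exact ⟨⟨a, b, span_pair_le hiF hj.2.2 c⟩, (span_pair_eq c fun hm => a (hs k b hm)).symm⟩
    rw [hfib, Finset.card_erase_of_mem (mem_flat.2 ⟨hi, mem_pair_left _ _⟩)]
    exact Nat.Odd.sub_odd ho odd_one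
  rw [Finset.card_erase_of_mem hiF'] at h1
  have h2 : 0 < #(flat v S F) := card_pos.2 ⟨i, hiF'⟩
  obtain ⟨a, ha⟩ := h1
  obtain ⟨b, hb⟩ := he
  omega

end DiscTwo

/-! ### Projection from a simple element -/

/-- Zero vectors and antipodal pairs can be removed without changing the sign sums. -/
lemma exists_reduced (v : ι → E) (S : Finset ι) :
    ∃ A ⊆ S, Reduced v A ∧ ∀ f, signSum v A f = signSum v S f := by
  classical
  induction S using Finset.strongInduction with
  | H S ih =>
    by_cases hS : Reduced v S
    · exact ⟨S, subset_rfl, hS, fun _ => rfl⟩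
    unfold Reduced at hS
    push Not at hS
    obtain ⟨i, hi, j, hj, c, hc, hc0⟩ := hS
    suffices H : ∃ T ⊂ S, ∀ f, signSum v T f = signSum v S f by
      obtain ⟨T, hT, h⟩ := H
      obtain ⟨A, hA, h1, h2⟩ := ih T hT
      exact ⟨A, hA.trans hT.1, h1, fun f => (h2 f).trans (h f)⟩
    by_cases hj0 : v j = 0
    · refine ⟨S.erase j, Finset.erase_ssubset hj, fun f => ?_⟩
      rw [signSum, signSum, ← Finset.add_sum_erase _ _ hj]
      simp [hj0]
    have hc' : c < 0 := lt_of_le_of_ne hc0 fun h0 => hj0 (by rw [hc, h0, zero_smul])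
    have hij : i ≠ j := by
      rintro rfl
      have : (1 - c) • v i = 0 := by rw [sub_smul, one_smul, ← hc, sub_self]
      rcases smul_eq_zero.1 this with h | h
      · linarith
      · exact hj0 h
    refine ⟨(S.erase j).erase i, (Finset.erase_subset _ _).trans_ssubset
      (Finset.erase_ssubset hj), fun f => ?_⟩
    rw [signSum, signSum, ← Finset.add_sum_erase _ _ hj,
      ← Finset.add_sum_erase (S.erase j) _ (Finset.mem_erase.2 ⟨hij, hi⟩)]
    have : sgn (f (v j)) = - sgn (f (v i)) := by
      rw [hc, map_smul, smul_eq_mul, ← neg_neg c, neg_mul, sgn_neg, sgn_pos_mul (by linarith)]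
    rw [this]; ring

namespace DiscTwo

variable {v : ι → E} {S : Finset ι}

/-- After projection from `i` and cancellation of zeros and antipodal pairs, the sign bound is 1, so
the quotient configuration has rank at most 2. An even line through `i` has an odd number of other
elements, so not all of them cancel and its direction survives. Hence all even lines through `i` lie
in one plane. -/
lemma evenLine_mem_plane (h : DiscTwo v S) {i j k l : ι} (hi : i ∈ S) (hj : j ∈ S) (hk : k ∈ S)
    (hl : l ∈ S) (hs : Simple v S i) (nj : EvenLine v S i j) (nk : EvenLine v S i k)
    (nl : EvenLine v S i l) (hkj : v k ∉ line v i j) : v l ∈ plane v i j k := by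
  classical
  obtain ⟨A, hAS, hA, hsum⟩ := exists_reduced (fun a => (ray v i).mkQ (v a)) S
  have hsum' : ∀ f : Module.Dual ℝ E, f (v i) = 0 → signSum v A f = signSum v S f := by
    intro f hf
    have hle : ray v i ≤ LinearMap.ker f := by
      rw [ray, Submodule.span_singleton_le_iff_mem]; exact hf
    exact hsum ((ray v i).liftQ f hle)
  have hmem : ∀ j ∈ S, EvenLine v S i j → ∃ a ∈ A, v a ∈ line v i j ∧ v a ∉ ray v i := by
    intro j hj nj
    obtain ⟨f, f1, f2, f3⟩ := exists_exact_flat v S (line v i j)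
    obtain ⟨g, g1, g2⟩ := exists_dual_eq_one nj.1
    have gi := g1 _ (Submodule.mem_span_singleton_self _)
    have fi := f1 _ (mem_pair_left _ _)
    obtain ⟨p, p0, -, p2⟩ := exists_signSum_add v S f g
    have e1 := p2 S subset_rfl
    have e2 := p2 A hAS
    rw [← hsum' p (p0 _ fi gi), ← hsum' f fi, f3] at e1
    have e3 : signSum v (flat v S (line v i j)) g = signSum v {i ∈ A | f (v i) = 0} g := by
      linarith
    have e4 : signSum v (flat v S (line v i j)) g ≠ 0 := by
      intro e0
      have him : i ∈ flat v S (line v i j) := mem_flat.2 ⟨hi, mem_pair_left _ _⟩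
      have e5 : signSum v ((flat v S (line v i j)).erase i) g = 0 := by
        rw [← e0, signSum, signSum, ← Finset.add_sum_erase _ _ him, gi, sgn_zero, zero_add]
      have e6 : Even (signSum v ((flat v S (line v i j)).erase i) g) := by
        rw [e5]; exact Even.zero
      rw [even_signSum_iff, Finset.card_erase_of_mem him] at e6
      · obtain ⟨a, ha⟩ := e6
        obtain ⟨b, hb⟩ := nj.2
        have := card_pos.2 ⟨i, him⟩
        omega
      · intro l hl
        rw [Finset.mem_erase, mem_flat] at hl
        obtain ⟨a, b, hab⟩ := mem_span_pair_iff.1 hl.2.2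
        have hb : b ≠ 0 := fun hb => hl.1 (hs l hl.2.1
          (mem_span_singleton_iff.2 ⟨a, by simpa [hb] using hab⟩))
        simpa [hab, gi, g2] using hb
    rw [e3] at e4
    obtain ⟨a, ha, -⟩ := Finset.exists_ne_zero_of_sum_ne_zero e4
    rw [mem_filter] at ha
    refine ⟨a, ha.1, ?_, fun hm => hA.ne_zero ha.1 (by simpa using hm)⟩
    have : a ∈ flat v S (line v i j) := by rw [← f3]; simp [hAS ha.1, ha.2]
    exact (mem_flat.1 this).2
  have hb : SignBound (fun a => (ray v i).mkQ (v a)) A 1 := by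
    intro g
    rw [hsum g]
    have h1 := signBound_add_ray h.red h.bound hi (f := g.comp (ray v i).mkQ)
      (by simp [(Submodule.Quotient.mk_eq_zero (ray v i)).2 (Submodule.mem_span_singleton_self _)])
    have h2 := card_ray_pos (v := v) hi
    change |signSum v S (g.comp (ray v i).mkQ)| ≤ 1
    omega
  have hlift : ∀ x y : E, (ray v i).mkQ x ∈ Submodule.span ℝ {(ray v i).mkQ y} →
      x ∈ Submodule.span ℝ {v i, y} := by
    intro x y hxy
    obtain ⟨c, hc⟩ := mem_span_singleton_iff.1 hxy
    rw [← map_smul, ← sub_eq_zero, ← map_sub] at hc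
    obtain ⟨d, hd⟩ := mem_span_singleton_iff.1 ((Submodule.Quotient.mk_eq_zero _).1 hc)
    exact mem_span_pair_iff.2 ⟨d, c, by rw [← hd]; abel⟩
  obtain ⟨a, ha, haj, hai⟩ := hmem j hj nj
  obtain ⟨b, hbA, hbk, hbi⟩ := hmem k hk nk
  obtain ⟨c, hcA, hcl, hci⟩ := hmem l hl nl
  have ea := span_pair_eq haj hai
  have eb := span_pair_eq hbk hbi
  have ec := span_pair_eq hcl hci
  have hba : v b ∉ line v i a := fun hm => hkj (by
    rw [line, ea]
    have h1 := span_pair_le (mem_pair_left _ _) hm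
    rw [← eb] at h1
    exact h1 (mem_pair_right _ _))
  have hc := hb.mem_span_pair hA ha hbA hcA fun hm => hba (hlift _ _ hm)
  obtain ⟨s, t, hst⟩ := mem_span_pair_iff.1 hc
  rw [← map_smul, ← map_smul, ← map_add, ← sub_eq_zero, ← map_sub] at hst
  obtain ⟨d, hd⟩ := mem_span_singleton_iff.1 ((Submodule.Quotient.mk_eq_zero _).1 hst)
  have h1 : v a ∈ plane v i j k :=
    span_pair_le (mem_plane_left _ _ _ _) (mem_plane_mid _ _ _ _) haj
  have h2 : v b ∈ plane v i j k :=
    span_pair_le (mem_plane_left _ _ _ _) (mem_plane_right _ _ _ _) hbk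
  have h3 : v c ∈ plane v i j k := by
    have : v c = d • v i + (s • v a + t • v b) := by rw [← hd]; abel
    rw [this]
    exact add_mem (Submodule.smul_mem _ _ (mem_plane_left _ _ _ _))
      (add_mem (Submodule.smul_mem _ _ h1) (Submodule.smul_mem _ _ h2))
  have h4 : v l ∈ line v i c := by rw [line, ← ec]; exact mem_pair_right _ _
  exact span_pair_le (mem_plane_left _ _ _ _) h3 h4

end DiscTwo

namespace DiscTwo

variable {v : ι → E} {S : Finset ι}

/-- All lines through `i` in a plane spanned by two such even lines are even. -/
lemma evenLine_of_mem_plane (h : DiscTwo v S) {i j k l : ι} (hi : i ∈ S) (hj : j ∈ S)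
    (hk : k ∈ S) (hl : l ∈ S) (hs : Simple v S i) (nj : EvenLine v S i j) (nk : EvenLine v S i k)
    (hkj : v k ∉ line v i j) (hlF : v l ∈ plane v i j k) (hli : v l ∉ ray v i) :
    EvenLine v S i l := by
  -- The plane through `i`, `l` and an outside element `a` has an even line through `i`. This line
  -- also lies in the plane of `i, j, k`, so it is the intersection of the two planes, the line
  -- through `i` and `l`.
  obtain ⟨a, ha, haF⟩ := h.rank i hi j hj k hk
  have hal : v a ∉ line v i l := fun hm => haF (span_pair_le (mem_plane_left _ _ _ _) hlF hm)
  obtain ⟨w, hw, hwF, nw⟩ := h.exists_evenLine hi hs ⟨i, hi, l, hl, a, ha, hli, hal, rfl⟩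
    (mem_plane_left _ _ _ _)
  have hw' := h.evenLine_mem_plane hi hj hk hw hs nj nk nw hkj
  have hwl : v w ∈ line v i l := by
    by_contra hcon
    refine notMem_span_triple_swap hcon (z := v w) (w := v a) (fun hm => haF ?_) hwF
    exact span_triple_le (mem_plane_left _ _ _ _) hlF hw' hm
  refine nw.congr ?_ hli
  rw [line, ← span_pair_eq hwl nw.1]
  exact mem_pair_right _ _

/-- A first plane through `i` gives one even line; a second plane through `i`, meeting the first in
a different line, gives another. -/
lemma exists_two_evenLines (h : DiscTwo v S) {i : ι} (hi : i ∈ S) (hs : Simple v S i) :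
    ∃ j ∈ S, ∃ k ∈ S, EvenLine v S i j ∧ EvenLine v S i k ∧ v k ∉ line v i j := by
  obtain ⟨a, ha, hai⟩ := h.rank i hi i hi i hi
  replace hai : v a ∉ ray v i := by simpa [plane] using hai
  obtain ⟨b, hb, hba⟩ := h.rank i hi a ha a ha
  replace hba : v b ∉ line v i a := by simpa [plane] using hba
  have hF : IsPlane v S (plane v i a b) := ⟨i, hi, a, ha, b, hb, hai, hba, rfl⟩
  obtain ⟨j, hj, hjF, nj⟩ := h.exists_evenLine hi hs hF (mem_plane_left _ _ _ _)
  obtain ⟨c, hc, hcF⟩ := h.rank i hi a ha b hb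
  obtain ⟨d, hd, hdF, hdj⟩ := hF.exists_notMem_line h.red i j
  have hdi : v d ∉ ray v i := fun hm => hdj (span_singleton_le_pair_left _ _ hm)
  have hcd : v c ∉ line v i d := fun hm => hcF (span_pair_le (mem_plane_left _ _ _ _) hdF hm)
  obtain ⟨k, hk, hkF, nk⟩ := h.exists_evenLine hi hs ⟨i, hi, d, hd, c, hc, hdi, hcd, rfl⟩
    (mem_plane_left _ _ _ _)
  refine ⟨j, hj, k, hk, nj, nk, fun hkj => ?_⟩
  have hkF' : v k ∈ plane v i a b := span_pair_le (mem_plane_left _ _ _ _) hjF hkj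
  have hkd : v k ∈ line v i d := by
    by_contra hcon
    refine notMem_span_triple_swap hcon (z := v k) (w := v c) (fun hm => hcF ?_) hkF
    exact span_triple_le (mem_plane_left _ _ _ _) hdF hkF' hm
  apply hdj
  rw [line, span_pair_eq hkj nk.1, ← span_pair_eq hkd nk.1]
  exact mem_pair_right _ _

/-! ### Good elements of a plane -/

lemma good_of_two_evenLines (h : DiscTwo v S) {i j k : ι} {F : Submodule ℝ E}
    (hF : IsPlane v S F) (hi : i ∈ S) (hj : j ∈ S) (hk : k ∈ S) (hs : Simple v S i)
    (hiF : v i ∈ F) (hjF : v j ∈ F) (hkF : v k ∈ F) (nj : EvenLine v S i j)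
    (nk : EvenLine v S i k) (hkj : v k ∉ line v i j) : Good v S i F := by
  intro l hl hlF hli
  rw [hF.eq h.red hi hiF hjF hkF nj.1 hkj] at hlF
  exact h.evenLine_of_mem_plane hi hj hk hl hs nj nk hkj hlF hli

lemma simple_of_not_good (h : DiscTwo v S) {i : ι} {F : Submodule ℝ E} (hi : i ∈ S)
    (hg : ¬ Good v S i F) : Simple v S i :=
  by_contra fun hs => hg (h.good_of_not_simple hi hs F)

/-- A second even line in `F` would make `i` or `j` good. So if their common line were even, all
their other lines in `F` would be odd, hence alternating, against `mem_span_pair_of_alternating`. -/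
lemma not_evenLine_of_not_good (h : DiscTwo v S) {i j : ι} {F : Submodule ℝ E}
    (hF : IsPlane v S F) (hi : i ∈ S) (hj : j ∈ S) (hiF : v i ∈ F) (hjF : v j ∈ F)
    (gi : ¬ Good v S i F) (gj : ¬ Good v S j F) : ¬ EvenLine v S i j := by
  intro n
  have si := h.simple_of_not_good hi gi
  have sj := h.simple_of_not_good hj gj
  have n' := n.symm h.red hi
  have key : ∀ i j, i ∈ S → j ∈ S → v i ∈ F → v j ∈ F → EvenLine v S i j → ¬ Good v S i F →
      ∀ y ∈ flat v S F, v y ∉ line v i j → Alternating v (flat v S F) i y := by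
    intro i j hi hj hiF hjF n gi y hy hyl
    have hy' := mem_flat.1 hy
    have hyi : v y ∉ ray v i := fun hm => hyl (span_singleton_le_pair_left _ _ hm)
    have ny : ¬ EvenLine v S i y := fun ny => gi (h.good_of_two_evenLines hF hi hj hy'.1
      (h.simple_of_not_good hi gi) hiF hjF hy'.2 n ny hyl)
    refine .of_signBound_one (h.red.mono (flat_subset _ _ _)) (mem_flat.2 ⟨hi, hiF⟩) hy ?_
    rw [flat_flat (span_pair_le hiF hy'.2)]
    exact h.bound_of_not_evenLine hyi ny
  obtain ⟨k, hk, hkF, hkl⟩ := hF.exists_notMem_line h.red i j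
  refine hkl (mem_span_pair_of_alternating (h.red.mono (flat_subset v S F))
    (mem_flat.2 ⟨hi, hiF⟩) (mem_flat.2 ⟨hj, hjF⟩) n.1 (key i j hi hj hiF hjF n gi) ?_
    (mem_flat.2 ⟨hk, hkF⟩))
  intro y hy hyl
  exact key j i hj hi hjF hiF n' gj y hy (by rwa [line_comm])

lemma exists_good (h : DiscTwo v S) {F : Submodule ℝ E} (hF : IsPlane v S F) :
    ∃ g ∈ S, v g ∈ F ∧ Good v S g F := by
  have hF' := hF
  obtain ⟨x, hx, y, -, z, -, -, -, rfl⟩ := hF'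
  have hxF := mem_plane_left v x y z
  by_cases gx : Good v S x (plane v x y z)
  · exact ⟨x, hx, hxF, gx⟩
  · obtain ⟨j, hj, hjF, n⟩ := h.exists_evenLine hx (h.simple_of_not_good hx gx) hF hxF
    refine ⟨j, hj, hjF, ?_⟩
    by_contra gj
    exact h.not_evenLine_of_not_good hF hx hj hxF hjF gx gj n

lemma good_of_notMem_line (h : DiscTwo v S) {F : Submodule ℝ E} (hF : IsPlane v S F) {g g' y : ι}
    (hg : g ∈ S) (hg' : g' ∈ S) (hy : y ∈ S) (hgF : v g ∈ F) (hgF' : v g' ∈ F) (hyF : v y ∈ F)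
    (gg : Good v S g F) (gg' : Good v S g' F) (hgg : v g' ∉ ray v g)
    (hyg : v y ∉ line v g g') : Good v S y F := by
  by_cases hs : Simple v S y
  · have n1 := (gg y hy hyF fun hm => hyg (span_singleton_le_pair_left _ _ hm)).symm h.red hg
    have n2 := (gg' y hy hyF fun hm => hyg
      (by rw [line_comm]; exact span_singleton_le_pair_left _ _ hm)).symm h.red hg'
    refine h.good_of_two_evenLines hF hy hg hg' hs hyF hgF hgF' n1 n2 ?_
    rw [line_comm]
    exact notMem_span_pair_swap hgg hyg
  · exact h.good_of_not_simple hy hs F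

/-- If two elements on different rays are good in a plane, then all elements are. -/
lemma good_of_good (h : DiscTwo v S) {F : Submodule ℝ E} (hF : IsPlane v S F) {g g' y : ι}
    (hg : g ∈ S) (hg' : g' ∈ S) (hy : y ∈ S) (hgF : v g ∈ F) (hgF' : v g' ∈ F) (hyF : v y ∈ F)
    (gg : Good v S g F) (gg' : Good v S g' F) (hgg : v g' ∉ ray v g) : Good v S y F := by
  obtain ⟨z, hz, hzF, hzl⟩ := hF.exists_notMem_line h.red g g'
  have gz := h.good_of_notMem_line hF hg hg' hz hgF hgF' hzF gg gg' hgg hzl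
  by_cases h1 : v y ∈ line v g g'
  swap
  · exact h.good_of_notMem_line hF hg hg' hy hgF hgF' hyF gg gg' hgg h1
  by_cases h2 : v y ∈ line v g z
  swap
  · exact h.good_of_notMem_line hF hg hz hy hgF hzF hyF gg gz
      (fun hm => hzl (span_singleton_le_pair_left _ _ hm)) h2
  refine h.good_of_notMem_line hF hg' hz hy hgF' hzF hyF gg' gz
      (fun hm => hzl (by rw [line_comm]; exact span_singleton_le_pair_left _ _ hm)) ?_
  -- In the remaining case `y` lies on two distinct lines through `g`, so on the ray of `g`, which
  -- the line through `g'` and `z` misses.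
  have h3 : v y ∈ ray v g := by
    by_contra hcon
    apply hzl
    rw [line, span_pair_eq h1 hcon, ← span_pair_eq h2 hcon]
    exact mem_pair_right _ _
  obtain ⟨c, hc⟩ := mem_span_singleton_iff.1 h3
  have hc0 := h.red g hg y hy c hc
  rw [hc, Submodule.smul_mem_iff _ hc0.ne', line_comm]
  intro hm
  exact hzl (mem_span_insert_exchange hm (notMem_span_singleton_symm (h.red.ne_zero hg) hgg))

/-- If a plane has a good element, and not all elements are good, then this element is alone on its
ray, and the other elements of the plane lie on a line. -/
lemma structure_of_good (h : DiscTwo v S) {F : Submodule ℝ E} (hF : IsPlane v S F) {g x : ι}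
    (hg : g ∈ S) (hx : x ∈ S) (hgF : v g ∈ F) (hxF : v x ∈ F)
    (gg : Good v S g F) (gx : ¬ Good v S x F) :
    Simple v S g ∧ ∀ u ∈ S, ∀ w ∈ S, ∀ y ∈ S, v u ∈ F → v w ∈ F → v y ∈ F →
      v u ∉ ray v g → v w ∉ ray v g → v y ∉ ray v g → u ≠ w → v y ∈ line v u w := by
  classical
  have hbad : ∀ u ∈ S, v u ∈ F → v u ∉ ray v g → ¬ Good v S u F := fun u hu huF hug gu =>
    gx (h.good_of_good hF hg hu hx hgF huF hxF gg gu hug)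
  -- Lines through `g` are even, so two bad elements on one of them would be joined by an even line.
  have hsingle : ∀ u ∈ S, ∀ w ∈ S, v u ∈ F → v w ∈ F → v u ∉ ray v g → v w ∉ ray v g →
      v w ∈ line v g u → w = u := by
    intro u hu w hw huF hwF hug hwg hwl
    by_contra hne
    have su := h.simple_of_not_good hu (hbad u hu huF hug)
    have hwu : v w ∉ ray v u := fun hm => hne (su w hw hm)
    refine h.not_evenLine_of_not_good hF hu hw huF hwF (hbad u hu huF hug) (hbad w hw hwF hwg) ?_
    exact ((gg u hu huF hug).symm h.red hg).congr (by rwa [line_comm]) hwu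
  have hgs : Simple v S g := by
    obtain ⟨u, hu, huF, hul⟩ := hF.exists_notMem_line h.red g g
    have hug : v u ∉ ray v g := by simpa [line] using hul
    have he := (gg u hu huF hug).2
    have hset : flat v S (line v g u) = insert u (flat v S (ray v g)) := by
      ext w
      simp only [mem_flat, Finset.mem_insert]
      constructor
      · rintro ⟨hw, hwl⟩
        by_cases hwg : v w ∈ ray v g
        · exact Or.inr ⟨hw, hwg⟩
        · exact Or.inl (hsingle u hu w hw huF (span_pair_le hgF huF hwl) hug hwg hwl)
      · rintro (rfl | ⟨hw, hwg⟩)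
        · exact ⟨hu, mem_pair_right _ _⟩
        · exact ⟨hw, span_singleton_le_pair_left _ _ hwg⟩
    rw [hset, Finset.card_insert_of_notMem (fun hm => hug (mem_flat.1 hm).2)] at he
    exact h.simple_of_odd hg (Submodule.mem_span_singleton_self (v g))
      (Nat.not_even_iff_odd.1 (Nat.even_add_one.1 he))
  refine ⟨hgs, ?_⟩
  intro u hu w hw y hy huF hwF hyF hug hwg hyg huw
  have hR : ∀ a, a ∈ (flat v S F).erase g ↔ a ∈ S ∧ v a ∈ F ∧ v a ∉ ray v g := by
    intro a
    rw [Finset.mem_erase, mem_flat]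
    refine ⟨fun ⟨a1, a2, a3⟩ => ⟨a2, a3, fun hm => a1 (hgs a a2 hm)⟩, fun ⟨a2, a3, a4⟩ =>
      ⟨?_, a2, a3⟩⟩
    rintro rfl
    exact a4 (Submodule.mem_span_singleton_self _)
  have hred : Reduced v ((flat v S F).erase g) :=
    h.red.mono ((Finset.erase_subset _ _).trans (flat_subset _ _ _))
  have hsimple : ∀ a ∈ S, v a ∈ F → v a ∉ ray v g → Simple v S a := fun a ha haF hag =>
    h.simple_of_not_good ha (hbad a ha haF hag)
  -- An even line through `a` and `b` would be a second even line at `a`, next to the one through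
  -- `g`, and make `a` good. So these lines are odd, and the extremal argument applies to the plane
  -- without `g`.
  have key : ∀ a ∈ (flat v S F).erase g, ∀ b ∈ (flat v S F).erase g, v b ∉ ray v a →
      Alternating v ((flat v S F).erase g) a b := by
    intro a ha b hb hba
    refine .of_signBound_one hred ha hb ?_
    rw [hR] at ha hb
    obtain ⟨ha, haF, hag⟩ := ha
    obtain ⟨hb, hbF, hbg⟩ := hb
    have hgl : v g ∉ line v a b := by
      intro hm
      have hga := notMem_span_singleton_symm (h.red.ne_zero hg) hag
      have : v b ∈ line v g a := by
        rw [line_comm, line, ← span_pair_eq hm hga]; exact mem_pair_right _ _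
      have := hsingle a ha b hb haF hbF hag hbg this
      subst this
      exact hba (Submodule.mem_span_singleton_self _)
    have hset : flat v ((flat v S F).erase g) (line v a b) = flat v S (line v a b) := by
      ext c
      simp only [mem_flat, Finset.mem_erase]
      refine ⟨fun hc => ⟨hc.1.2.1, hc.2⟩, fun hc => ⟨⟨?_, hc.1, span_pair_le haF hbF hc.2⟩, hc.2⟩⟩
      rintro rfl
      exact hgl hc.2
    change SignBound v (flat v ((flat v S F).erase g) (line v a b)) 1
    rw [hset]
    refine h.bound_of_not_evenLine hba fun n => hbad a ha haF hag ?_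
    exact h.good_of_two_evenLines hF ha hb hg (hsimple a ha haF hag) haF hbF hgF n
      ((gg a ha haF hag).symm h.red hg) hgl
  have hu' := (hR u).2 ⟨hu, huF, hug⟩
  have hw' := (hR w).2 ⟨hw, hwF, hwg⟩
  refine mem_span_pair_of_alternating hred hu' hw'
    (fun hm => huw (hsimple u hu huF hug w hw hm).symm) ?_ ?_ ((hR y).2 ⟨hy, hyF, hyg⟩)
  · exact fun z hz hzl => key u hu' z hz fun hm => hzl (span_singleton_le_pair_left _ _ hm)
  · exact fun z hz hzl => key w hw' z hz fun hm => hzl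
      (by rw [Set.pair_comm]; exact span_singleton_le_pair_left _ _ hm)

/-- A plane with an element that is alone on its ray has an element that is not good. -/
lemma exists_not_good (h : DiscTwo v S) {F : Submodule ℝ E} (hF : IsPlane v S F) {x : ι}
    (hx : x ∈ S) (hxF : v x ∈ F) (hs : Simple v S x) : ∃ y ∈ S, v y ∈ F ∧ ¬ Good v S y F := by
  by_contra! hall
  -- If all elements of `F` are good, the even lines at a simple element of `F` already span `F`, so
  -- none leaves it. A good element of a plane crossing `F` will violate this.
  have hstar : ∀ x ∈ S, v x ∈ F → Simple v S x → ∀ y ∈ S, v y ∉ F → ¬ EvenLine v S x y := by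
    intro x hx hxF hs y hy hyF n
    obtain ⟨a, ha, haF, hax⟩ := hF.exists_notMem_line h.red x x
    replace hax : v a ∉ ray v x := by simpa [line] using hax
    obtain ⟨b, hb, hbF, hba⟩ := hF.exists_notMem_line h.red x a
    have hbx : v b ∉ ray v x := fun hm => hba (span_singleton_le_pair_left _ _ hm)
    exact hyF (span_triple_le hxF haF hbF (h.evenLine_mem_plane hx ha hb hy hs
      (hall x hx hxF a ha haF hax) (hall x hx hxF b hb hbF hbx) n hba))
  obtain ⟨a, ha, haF, hax⟩ := hF.exists_notMem_line h.red x x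
  replace hax : v a ∉ ray v x := by simpa [line] using hax
  obtain ⟨b, hb, hbF, hba⟩ := hF.exists_notMem_line h.red x a
  obtain ⟨y, hy, hyF⟩ := h.rank x hx a ha b hb
  rw [← hF.eq h.red hx hxF haF hbF hax hba] at hyF
  have hyl : v y ∉ line v x a := fun hm => hyF (span_pair_le hxF haF hm)
  have hyx : v y ∉ ray v x := fun hm => hyF ((Submodule.span_singleton_le_iff_mem _ _).2 hxF hm)
  have hG : IsPlane v S (plane v x a y) := ⟨x, hx, a, ha, y, hy, hax, hyl, rfl⟩
  have hxG := mem_plane_left v x a y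
  have hyG := mem_plane_right v x a y
  have bx : ¬ Good v S x (plane v x a y) := fun gx => hstar x hx hxF hs y hy hyF
    (gx y hy hyG hyx)
  obtain ⟨g, hg, hgG, gg⟩ := h.exists_good hG
  have hgx : v g ∉ ray v x := by
    intro hm
    rw [hs g hg hm] at gg
    exact bx gg
  have hxg := notMem_span_singleton_symm (h.red.ne_zero hx) hgx
  have ng := (gg x hx hxG hxg).symm h.red hg
  have hgl : v g ∈ line v x a := by
    by_contra hcon
    exact bx (h.good_of_two_evenLines hG hx ha hg hs hxG (mem_plane_mid v x a y) hgG
      (hall x hx hxF a ha haF hax) ng hcon)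
  have hgF : v g ∈ F := span_pair_le hxF haF hgl
  have hgs := (h.structure_of_good hG hg hx hgG hxG gg bx).1
  exact hstar g hg hgF hgs y hy hyF
    (gg y hy hyG fun hm => hyF ((Submodule.span_singleton_le_iff_mem _ _).2 hgF hm))

/-- If every ray had two elements, a functional vanishing at any element would have sign sum 0, and
all lines would be alternating because `2 < 2 + 2`. The rank would then be at most 2. -/
lemma exists_simple (h : DiscTwo v S) (hne : S.Nonempty) : ∃ i ∈ S, Simple v S i := by
  by_contra! hns
  have hcard : ∀ i ∈ S, 2 ≤ #(flat v S (ray v i)) := by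
    intro i hi
    by_contra hlt
    refine hns i hi fun j hj hm => ?_
    exact Finset.card_le_one.1 (by omega) j (mem_flat.2 ⟨hj, hm⟩) i
      (mem_flat.2 ⟨hi, Submodule.mem_span_singleton_self _⟩)
  have hzero : ∀ i ∈ S, ∀ f : Module.Dual ℝ E, f (v i) = 0 → signSum v S f = 0 := by
    intro i hi f hf
    have h1 := signBound_add_ray h.red h.bound hi hf
    have h2 := hcard i hi
    rw [ray] at h2
    exact abs_eq_zero.1 (le_antisymm (by omega) (abs_nonneg _))
  have key : ∀ i ∈ S, ∀ j ∈ S, Alternating v S i j := by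
    intro i hi j hj
    constructor
    · intro g hg
      obtain ⟨f, f1, f2, f3⟩ := exists_exact_flat v S (line v i j)
      have fi := f1 _ (mem_pair_left _ _)
      obtain ⟨p, p0, -, p2⟩ := exists_signSum_add v S f g
      have e := p2 S subset_rfl
      rw [hzero i hi p (p0 _ fi hg), hzero i hi f fi, f3] at e
      change signSum v (flat v S (line v i j)) g = 0
      linarith
    · intro f
      have h1 := h.bound.restrict (line v i j) f
      have h2 := hcard i hi
      have h3 := hcard j hj
      have : ((2 : ℕ) : ℤ) < #(flat v S (ray v i)) + #(flat v S (ray v j)) := by omega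
      exact lt_of_le_of_lt h1 this
  obtain ⟨i, hi⟩ := hne
  obtain ⟨a, ha, hai⟩ := h.rank i hi i hi i hi
  replace hai : v a ∉ ray v i := by simpa [plane] using hai
  obtain ⟨b, hb, hba⟩ := h.rank i hi a ha a ha
  replace hba : v b ∉ line v i a := by simpa [plane] using hba
  exact hba (mem_span_pair_of_alternating h.red hi ha hai (fun y hy _ => key i hi y hy)
    (fun y hy _ => key a ha y hy) hb)

/-! ### Splitting into two odd lines -/

/-- A reduced configuration of even size and rank at least four with sign sums at most two splits
into two parts with sign sums at most one. -/
theorem exists_split (h : DiscTwo v S) (hne : S.Nonempty) :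
    ∃ A B : Finset ι, A ⊆ S ∧ B ⊆ S ∧ Disjoint A B ∧ #A + #B = #S ∧ 3 ≤ #A ∧ 3 ≤ #B ∧
      SignBound v A 1 ∧ SignBound v B 1 := by
  classical
  obtain ⟨i, hi, hs⟩ := h.exists_simple hne
  obtain ⟨j, hj, k, hk, nj, nk, hkj⟩ := h.exists_two_evenLines hi hs
  have hki : v k ∉ ray v i := nk.1
  have hH : IsPlane v S (plane v i j k) := ⟨i, hi, j, hj, k, hk, nj.1, hkj, rfl⟩
  set H := plane v i j k with hHdef
  have hiH : v i ∈ H := mem_plane_left _ _ _ _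
  have hjH : v j ∈ H := mem_plane_mid _ _ _ _
  have hkH : v k ∈ H := mem_plane_right _ _ _ _
  have gi : Good v S i H := h.good_of_two_evenLines hH hi hj hk hs hiH hjH hkH nj nk hkj
  obtain ⟨x, hx, hxH, bx⟩ := h.exists_not_good hH hi hiH hs
  have hcol := (h.structure_of_good hH hi hx hiH hxH gi bx).2
  obtain ⟨a, ha, haH⟩ := h.rank i hi j hj k hk
  have hodd : ∀ b ∈ S, v b ∉ H → ¬ EvenLine v S i b := fun b hb hbH n =>
    hbH (h.evenLine_mem_plane hi hj hk hb hs nj nk n hkj)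
  have hray : ∀ b, v b ∉ H → v b ∉ ray v i := fun b hbH hm =>
    hbH ((Submodule.span_singleton_le_iff_mem _ _).2 hiH hm)
  -- Otherwise `i` is bad in the plane of `i, a, b`, which has a good element `g`. None of `i, a, b`
  -- is on its ray, so `structure_of_good` makes them collinear.
  have hcover : ∀ b ∈ S, v b ∉ H → v b ∈ line v i a := by
    intro b hb hbH
    by_contra hbl
    have hF : IsPlane v S (plane v i a b) := ⟨i, hi, a, ha, b, hb, hray a haH, hbl, rfl⟩
    have hiF := mem_plane_left v i a b
    have haF := mem_plane_mid v i a b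
    have hbF := mem_plane_right v i a b
    have bi : ¬ Good v S i (plane v i a b) := fun g => hodd a ha haH (g a ha haF (hray a haH))
    obtain ⟨g, hg, hgF, gg⟩ := h.exists_good hF
    obtain ⟨gs, hc⟩ := h.structure_of_good hF hg hi hgF hiF gg bi
    have hig : v i ∉ ray v g := by
      intro hm
      rw [← gs i hi hm] at gg
      exact bi gg
    have hgi := notMem_span_singleton_symm (h.red.ne_zero hi)
      (fun hm => hig (by rw [hs g hg hm]; exact Submodule.mem_span_singleton_self _))
    have ng := (gg i hi hiF hig).symm h.red hg
    have hne : ∀ c ∈ S, v c ∉ H → v c ∉ ray v g := by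
      intro c hc hcH hm
      rw [← gs c hc hm] at ng
      exact hodd c hc hcH ng
    refine hbl (hc i hi a ha b hb hiF haF hbF hig (hne a ha haH) (hne b hb hbH) ?_)
    rintro rfl
    exact haH hiH
  have hlH : ∀ b ∈ S, v b ∈ line v i a → v b ∈ H → b = i := by
    intro b hb hbl hbH
    by_contra hbi
    have := span_pair_eq hbl fun hm => hbi (hs b hb hm)
    apply haH
    refine span_pair_le hiH hbH ?_
    rw [← this]
    exact mem_pair_right _ _
  have hil : v i ∉ line v j k := by
    rw [line_comm]
    intro hm
    have h1 := notMem_span_singleton_symm (h.red.ne_zero hi) hki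
    have := span_pair_eq hm h1
    apply hkj
    have h2 := notMem_span_pair_swap nj.1 hkj
    exact absurd (by rw [Set.pair_comm, ← this]; exact mem_pair_right _ _) h2
  have hsplit : flat v S (line v j k) = S \ flat v S (line v i a) := by
    ext w
    simp only [mem_flat, Finset.mem_sdiff, not_and]
    constructor
    · rintro ⟨hw, hwl⟩
      refine ⟨hw, fun _ hwa => ?_⟩
      have := hlH w hw hwa (span_pair_le hjH hkH hwl)
      exact hil (this ▸ hwl)
    · rintro ⟨hw, hwa⟩
      have hwH : v w ∈ H := by_contra fun hwH => hwa hw (hcover w hw hwH)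
      refine ⟨hw, hcol j hj k hk w hw hjH hkH hwH nj.1 hki
        (fun hm => hwa hw (span_singleton_le_pair_left _ _ hm)) ?_⟩
      rintro rfl
      exact hkj (mem_pair_right _ _)
  have oA : Odd #(flat v S (line v i a)) :=
    Nat.not_even_iff_odd.1 fun he => hodd a ha haH ⟨hray a haH, he⟩
  have hsum : #(flat v S (line v i a)) + #(flat v S (line v j k)) = #S := by
    rw [hsplit, add_comm, Finset.card_sdiff_add_card_eq_card (flat_subset _ _ _)]
  have oB : Odd #(flat v S (line v j k)) := by
    have := h.even
    rw [← hsum, Nat.even_add] at this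
    rw [← Nat.not_even_iff_odd] at oA ⊢
    tauto
  have two : ∀ p ∈ S, ∀ q ∈ S, p ≠ q → Odd #(flat v S (line v p q)) →
      3 ≤ #(flat v S (line v p q)) := by
    intro p hp q hq hpq ho
    have := Finset.one_lt_card.2 ⟨p, mem_flat.2 ⟨hp, mem_pair_left _ _⟩, q,
      mem_flat.2 ⟨hq, mem_pair_right (v p) (v q)⟩, hpq⟩
    obtain ⟨c, hc⟩ := ho
    rw [line] at hc ⊢
    omega
  refine ⟨flat v S (line v i a), flat v S (line v j k), flat_subset _ _ _, flat_subset _ _ _,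
    ?_, hsum, two i hi a ha ?_ oA, two j hj k hk ?_ oB, h.bound.restrict_of_odd h.even oA,
    h.bound.restrict_of_odd h.even oB⟩
  · rw [hsplit]; exact Finset.disjoint_sdiff
  · rintro rfl; exact haH hiH
  · rintro rfl; exact hkj (mem_pair_right _ _)

end DiscTwo

/-! ### Dual codegree and sign sums -/

lemma dualCodegree_le (v : ι → E) (S : Finset ι) (f : Module.Dual ℝ E) :
    dualCodegree v S ≤ #{i ∈ S | f (v i) ≤ 0} := Nat.sInf_le ⟨f, rfl⟩

lemma exists_dualCodegree_eq (v : ι → E) (S : Finset ι) :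
    ∃ f : Module.Dual ℝ E, #{i ∈ S | f (v i) ≤ 0} = dualCodegree v S :=
  Nat.sInf_mem (Set.range_nonempty fun f : Module.Dual ℝ E => #{i ∈ S | f (v i) ≤ 0})

lemma card_pos_add_card_nonpos (v : ι → E) (S : Finset ι) (f : Module.Dual ℝ E) :
    #{i ∈ S | 0 < f (v i)} + #{i ∈ S | f (v i) ≤ 0} = #S := by
  simpa only [not_lt] using S.card_filter_add_card_filter_not (fun i => 0 < f (v i))

lemma signSum_eq (v : ι → E) (S : Finset ι) (f : Module.Dual ℝ E) :
    signSum v S f = (#{i ∈ S | 0 < f (v i)} : ℤ) - #{i ∈ S | f (v i) < 0} := by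
  rw [signSum, Finset.card_filter, Finset.card_filter]
  push_cast
  rw [← Finset.sum_sub_distrib]
  refine Finset.sum_congr rfl fun i _ => ?_
  rcases lt_trichotomy (f (v i)) 0 with h | h | h
  · simp [sgn_of_neg h, h, h.not_gt]
  · simp [h]
  · simp [sgn_of_pos h, h, h.not_gt]

lemma card_neg_le_card_nonpos (v : ι → E) (S : Finset ι) (f : Module.Dual ℝ E) :
    #{i ∈ S | f (v i) < 0} ≤ #{i ∈ S | f (v i) ≤ 0} :=
  card_le_card (monotone_filter_right _ fun _ _ => le_of_lt)

/-- For a functional that does not vanish on nonzero elements, the nonpositive elements are the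
negative ones and the zero vectors. -/
lemma card_nonpos_eq {v : ι → E} {S : Finset ι} {f : Module.Dual ℝ E} [DecidablePred (v · = 0)]
    (h : ∀ i ∈ S, v i ≠ 0 → f (v i) ≠ 0) :
    #{i ∈ S | f (v i) ≤ 0} = #{i ∈ S | f (v i) < 0} + #{i ∈ S | v i = 0} := by
  classical
  rw [← card_union_of_disjoint]
  · congr 1
    ext i
    simp only [mem_filter, mem_union]
    constructor
    · rintro ⟨hi, hle⟩
      by_cases h0 : v i = 0
      · exact Or.inr ⟨hi, h0⟩
      · exact Or.inl ⟨hi, lt_of_le_of_ne hle (h i hi h0)⟩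
    · rintro (⟨hi, hlt⟩ | ⟨hi, h0⟩)
      · exact ⟨hi, hlt.le⟩
      · exact ⟨hi, by simp [h0]⟩
  · rw [disjoint_filter]
    intro i _ hlt h0
    simp [h0] at hlt

lemma exists_generic_pos (v : ι → E) (S : Finset ι) (f : Module.Dual ℝ E) :
    ∃ h : Module.Dual ℝ E, (∀ i ∈ S, v i ≠ 0 → h (v i) ≠ 0) ∧
      ∀ i ∈ S, 0 < f (v i) → 0 < h (v i) := by
  obtain ⟨g, -, hg⟩ := exists_exact v S ⊥
  obtain ⟨h, -, h1, h2⟩ := exists_perturb v S f g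
  have key : ∀ i ∈ S, 0 < f (v i) → 0 < h (v i) := by
    intro i hi hf
    have := h1 i hi hf.ne'
    rw [sgn_of_pos hf] at this
    by_contra hcon
    rcases (not_lt.1 hcon).lt_or_eq with h' | h'
    · rw [sgn_of_neg h'] at this; exact absurd this (by decide)
    · rw [h', sgn_zero] at this; exact absurd this (by decide)
  refine ⟨h, fun i hi h0 hz => ?_, key⟩
  by_cases hf : f (v i) = 0
  · have h3 := odd_sgn (hg i hi (by simpa using h0))
    rw [← h2 i hi hf, hz, sgn_zero] at h3
    exact absurd h3 (by decide)
  · have h3 := odd_sgn hf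
    rw [← h1 i hi hf, hz, sgn_zero] at h3
    exact absurd h3 (by decide)

lemma exists_generic_signSum (v : ι → E) (S : Finset ι) (f : Module.Dual ℝ E) :
    ∃ h : Module.Dual ℝ E, (∀ i ∈ S, v i ≠ 0 → h (v i) ≠ 0) ∧ signSum v S f ≤ signSum v S h := by
  obtain ⟨g, -, hg⟩ := exists_exact v S ⊥
  have hg' : ∀ i ∈ S, v i ≠ 0 → g (v i) ≠ 0 := fun i hi h0 => hg i hi (by simpa using h0)
  rcases le_total 0 (signSum v {i ∈ S | f (v i) = 0} g) with hs | hs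
  · obtain ⟨h, -, h1, h2⟩ := exists_signSum_add v S f g
    exact ⟨h, fun i hi h0 => h1 i hi (Or.inr (hg' i hi h0)), by rw [h2 S subset_rfl]; linarith⟩
  · obtain ⟨h, -, h1, h2⟩ := exists_signSum_add v S f (-g)
    exact ⟨h, fun i hi h0 => h1 i hi (Or.inr (by simpa using hg' i hi h0)),
      by rw [h2 S subset_rfl, signSum_neg]; linarith⟩

lemma SignBound.card_le {v : ι → E} {S : Finset ι} {D : ℤ} (h : SignBound v S D) :
    (#S : ℤ) ≤ 2 * dualCodegree v S + D := by
  obtain ⟨f, hf⟩ := exists_dualCodegree_eq v S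
  have h1 := card_pos_add_card_nonpos v S f
  have h2 := signSum_eq v S f
  have h3 := (abs_le.1 (h f)).2
  have h4 := card_neg_le_card_nonpos v S f
  omega

lemma signBound_of_ne_zero {v : ι → E} {S : Finset ι} (h : ∀ i ∈ S, v i ≠ 0) :
    SignBound v S (#S - 2 * dualCodegree v S) := by
  classical
  have key : ∀ f, signSum v S f ≤ #S - 2 * dualCodegree v S := by
    intro f
    obtain ⟨g, hg, hfg⟩ := exists_generic_signSum v S f
    have h1 := card_pos_add_card_nonpos v S g
    have h2 := signSum_eq v S g
    have h3 := card_nonpos_eq hg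
    have h4 := dualCodegree_le v S g
    have h5 : #{i ∈ S | v i = 0} = 0 := by
      rw [card_eq_zero, filter_eq_empty_iff]; exact fun i hi => h i hi
    omega
  intro f
  have h1 := key f
  have h2 := key (-f)
  rw [signSum_neg] at h2
  exact abs_le.2 ⟨by linarith, h1⟩

/-- The dual codegree is superadditive. -/
lemma sum_dualCodegree_le {v : ι → E} {S : Finset ι} {m : ℕ} {P : Fin m → Finset ι}
    (hP : ∀ i, P i ⊆ S) (hd : ∀ i j, i ≠ j → Disjoint (P i) (P j)) :
    ∑ i, dualCodegree v (P i) ≤ dualCodegree v S := by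
  classical
  obtain ⟨f, hf⟩ := exists_dualCodegree_eq v S
  rw [← hf]
  refine (Finset.sum_le_sum fun i _ => dualCodegree_le v (P i) f).trans ?_
  rw [← Finset.card_biUnion fun i _ j _ hij => disjoint_filter_filter (hd i j hij)]
  refine card_le_card fun x hx => ?_
  simp only [mem_biUnion, mem_filter] at hx ⊢
  obtain ⟨i, -, hi, hx⟩ := hx
  exact ⟨hP i hi, hx⟩

/-! ### Packings by factors of positive codegree -/

/-- The dimension of the span of a subconfiguration. -/
noncomputable def spanRank (v : ι → E) (S : Finset ι) : ℕ :=
  Module.finrank ℝ (Submodule.span ℝ (v '' S))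

instance finiteDimensional_span_image (v : ι → E) (S : Finset ι) :
    FiniteDimensional ℝ (Submodule.span ℝ (v '' S)) :=
  FiniteDimensional.span_of_finite ℝ (S.finite_toSet.image v)

lemma spanRank_le_card (v : ι → E) (S : Finset ι) : spanRank v S ≤ #S := by
  classical
  have h := finrank_span_finset_le_card (R := ℝ) (S.image v)
  rw [Set.finrank, Finset.coe_image] at h
  exact h.trans card_image_le

lemma spanRank_mono (v : ι → E) {S T : Finset ι} (h : T ⊆ S) : spanRank v T ≤ spanRank v S :=
  Submodule.finrank_mono (Submodule.span_mono (Set.image_mono (by exact_mod_cast h)))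

lemma exists_notMem_of_finrank_lt {v : ι → E} {S : Finset ι} {W : Submodule ℝ E}
    [FiniteDimensional ℝ W] (h : Module.finrank ℝ W < spanRank v S) : ∃ a ∈ S, v a ∉ W := by
  by_contra! hcon
  have h1 : Submodule.span ℝ (v '' S) ≤ W := by
    rw [Submodule.span_le]; rintro _ ⟨i, hi, rfl⟩; exact hcon i hi
  exact absurd (Submodule.finrank_mono h1) (not_le.2 h)

/-- Pairwise disjoint subconfigurations of positive dual codegree in `S`, whose dual codegrees add
up to at least that of `S`. -/
structure IsPacking (v : ι → E) (S : Finset ι) {m : ℕ} (P : Fin m → Finset ι) : Prop where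
  subset : ∀ i, P i ⊆ S
  disjoint : ∀ i j, i ≠ j → Disjoint (P i) (P j)
  one_le : ∀ i, 1 ≤ dualCodegree v (P i)
  le_sum : dualCodegree v S ≤ ∑ i, dualCodegree v (P i)

lemma IsPacking.cons {v : ι → E} {S S' T : Finset ι} {m : ℕ} {P : Fin m → Finset ι}
    (h : IsPacking v S' P) (hS : S' ⊆ S) (hT : T ⊆ S) (hd : Disjoint T S')
    (h1 : 1 ≤ dualCodegree v T) (hle : dualCodegree v S ≤ dualCodegree v S' + 1) :
    IsPacking v S (Fin.cons T P : Fin (m + 1) → Finset ι) := by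
  constructor
  · exact Fin.cases hT fun i => (h.subset i).trans hS
  · have hTP : ∀ i, Disjoint T (P i) := fun i => hd.mono_right (h.subset i)
    refine Fin.cases (Fin.cases (by simp) fun j _ => hTP j) fun i => Fin.cases
      (fun _ => (hTP i).symm) fun j hij => ?_
    exact h.disjoint i j fun e => hij (by rw [e])
  · exact Fin.cases h1 h.one_le
  · have := h.le_sum
    rw [Fin.sum_univ_succ]
    simp only [Fin.cons_zero, Fin.cons_succ]
    omega

lemma card_filter_erase_add_one {α : Type*} [DecidableEq α] {S : Finset α} {p : α → Prop}
    [DecidablePred p] (i : α) : #{j ∈ S | p j} ≤ #{j ∈ S.erase i | p j} + 1 := by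
  rw [Finset.filter_erase]
  have := Finset.pred_card_le_card_erase (s := {j ∈ S | p j}) (a := i)
  omega

/-- Existence of codegree decompositions, for a reduced configuration of rank at most four. -/
lemma exists_packing_of_reduced {v : ι → E} {S : Finset ι} (hS : Reduced v S)
    (hr : spanRank v S ≤ 4) : ∃ (m : ℕ) (P : Fin m → Finset ι), IsPacking v S P ∧
      2 * dualCodegree v S + spanRank v S ≤ m + #S := by
  by_cases hc : dualCodegree v S = 0
  · refine ⟨0, Fin.elim0, ⟨fun i => i.elim0, fun i => i.elim0, fun i => i.elim0, by simp [hc]⟩, ?_⟩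
    have := spanRank_le_card v S
    omega
  by_cases hsmall : 2 * dualCodegree v S + spanRank v S ≤ 1 + #S
  · refine ⟨1, fun _ => S, ⟨fun _ => subset_rfl, fun i j hij => (hij (Subsingleton.elim _ _)).elim,
      fun _ => Nat.one_le_iff_ne_zero.2 hc, by simp⟩, hsmall⟩
  have hb := signBound_of_ne_zero (v := v) (S := S) fun i hi => hS.ne_zero hi
  -- Length 1 being too short, the rank exceeds this number by at least 2, and the rank is at most
  -- 4.
  have hD : (#S : ℤ) - 2 * dualCodegree v S ≤ 2 := by omega
  have hne : S.Nonempty := by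
    rw [Finset.nonempty_iff_ne_empty]
    rintro rfl
    have := spanRank_le_card v (∅ : Finset ι)
    have := dualCodegree_le v (∅ : Finset ι) 0
    simp at this
    exact hc this
  obtain ⟨i, hi⟩ := hne
  have f0 := FiniteDimensional.span_of_finite ℝ (Set.toFinite {v i})
  have h1 : (1 : ℤ) ≤ #S - 2 * dualCodegree v S := by
    obtain ⟨f, -, hf⟩ := hS.exists_le_signSum hi
    have := card_ray_pos (v := v) hi
    have := hb f
    omega
  by_cases hone : (#S : ℤ) - 2 * dualCodegree v S = 1
  · exfalso
    rw [hone] at hb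
    have e0 := finrank_span_singleton (K := ℝ) (hS.ne_zero hi)
    obtain ⟨j, hj, hji⟩ := exists_notMem_of_finrank_lt (v := v) (S := S)
      (W := Submodule.span ℝ {v i}) (by omega)
    have f1 := FiniteDimensional.span_of_finite ℝ (Set.toFinite {v i, v j})
    have e1 := finrank_span_pair_le (v i) (v j)
    obtain ⟨k, hk, hkl⟩ := exists_notMem_of_finrank_lt (v := v) (S := S)
      (W := Submodule.span ℝ {v i, v j}) (by omega)
    exact hkl (hb.mem_span_pair hS hi hj hk hji)
  have htwo : (#S : ℤ) - 2 * dualCodegree v S = 2 := by omega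
  rw [htwo] at hb
  have hT : DiscTwo v S := by
    refine ⟨hS, hb, ⟨dualCodegree v S + 1, by omega⟩, fun x _ y _ z _ => ?_⟩
    classical
    have f1 := FiniteDimensional.span_of_finite ℝ (Set.toFinite {v x, v y, v z})
    have h6 := finrank_span_finset_le_card (R := ℝ) ({v x, v y, v z} : Finset E)
    have h7 : #({v x, v y, v z} : Finset E) ≤ 3 := card_le_three
    rw [Set.finrank] at h6
    rw [show (({v x, v y, v z} : Finset E) : Set E) = {v x, v y, v z} by ext; simp] at h6
    exact exists_notMem_of_finrank_lt (by rw [plane]; omega)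
  -- By `SignBound.card_le` the two codegrees are at least `(#A - 1) / 2` and `(#B - 1) / 2`. These
  -- are positive as both sizes are at least 3, and add up to `(#S - 2) / 2`, the codegree of `S`.
  obtain ⟨A, B, hA, hB, hAB, hcard, cA, cB, bA, bB⟩ := hT.exists_split ⟨i, hi⟩
  have hA' := bA.card_le
  have hB' := bB.card_le
  refine ⟨2, ![A, B], ⟨?_, ?_, ?_, ?_⟩, by omega⟩
  · intro i; fin_cases i
    exacts [hA, hB]
  · intro i j hij
    fin_cases i <;> fin_cases j
    exacts [(hij rfl).elim, hAB, hAB.symm, (hij rfl).elim]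
  · intro i; fin_cases i
    · change 1 ≤ dualCodegree v A; omega
    · change 1 ≤ dualCodegree v B; omega
  · rw [Fin.sum_univ_two]
    change dualCodegree v S ≤ dualCodegree v A + dualCodegree v B
    omega

/-- Existence of codegree decompositions, for a configuration of rank at most four. -/
theorem exists_packing (v : ι → E) (S : Finset ι) (hr : spanRank v S ≤ 4) :
    ∃ (m : ℕ) (P : Fin m → Finset ι), IsPacking v S P ∧
      2 * dualCodegree v S + spanRank v S ≤ m + #S := by
  classical
  induction S using Finset.strongInduction with
  | H S ih =>
    by_cases hS : Reduced v S
    · exact exists_packing_of_reduced hS hr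
    -- The last two inequalities say that passing to `S'` lowers the required length `2 *
    -- dualCodegree + spanRank - card` by at most 1, which the factor `T` pays for.
    suffices H : ∃ S' T, S' ⊂ S ∧ T ⊆ S ∧ Disjoint T S' ∧ 1 ≤ dualCodegree v T ∧
        dualCodegree v S ≤ dualCodegree v S' + 1 ∧ spanRank v S + #S' + 1 ≤ spanRank v S' + #S by
      obtain ⟨S', T, hS', hT, hd, h1, hle, hrk⟩ := H
      obtain ⟨m, P, hP, hm⟩ := ih S' hS' ((spanRank_mono v hS'.1).trans hr)
      exact ⟨m + 1, _, hP.cons hS'.1 hT hd h1 hle, by omega⟩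
    by_cases hz : ∃ i ∈ S, v i = 0
    · obtain ⟨i, hi, h0⟩ := hz
      refine ⟨S.erase i, {i}, Finset.erase_ssubset hi, by simpa using hi, by simp, ?_, ?_, ?_⟩
      · obtain ⟨f, hf⟩ := exists_dualCodegree_eq v {i}
        rw [← hf, Nat.one_le_iff_ne_zero, Finset.card_ne_zero]
        exact ⟨i, by simp [h0]⟩
      · obtain ⟨f, hf⟩ := exists_dualCodegree_eq v (S.erase i)
        rw [← hf]
        exact (dualCodegree_le v S f).trans (card_filter_erase_add_one i)
      · have : spanRank v S ≤ spanRank v (S.erase i) := by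
          refine Submodule.finrank_mono (Submodule.span_le.2 ?_)
          rintro _ ⟨j, hj, rfl⟩
          by_cases hji : j = i
          · rw [hji, h0]; exact zero_mem _
          · exact Submodule.subset_span ⟨j, by simpa [hji] using hj, rfl⟩
        have := Finset.card_erase_add_one hi
        omega
    push Not at hz
    unfold Reduced at hS
    push Not at hS
    obtain ⟨i, hi, j, hj, c, hc, hc0⟩ := hS
    have hc' : c < 0 := lt_of_le_of_ne hc0 fun h0 => hz j hj (by rw [hc, h0, zero_smul])
    have hij : i ≠ j := by
      rintro rfl
      have : (1 - c) • v i = 0 := by rw [sub_smul, one_smul, ← hc, sub_self]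
      rcases smul_eq_zero.1 this with h | h
      · linarith
      · exact hz _ hi h
    have hiS : i ∈ S.erase j := Finset.mem_erase.2 ⟨hij, hi⟩
    refine ⟨(S.erase j).erase i, {i, j}, (Finset.erase_subset _ _).trans_ssubset
      (Finset.erase_ssubset hj), by simp [Finset.insert_subset_iff, hi, hj], by simp, ?_, ?_, ?_⟩
    · obtain ⟨f, hf⟩ := exists_dualCodegree_eq v {i, j}
      rw [← hf, Nat.one_le_iff_ne_zero, Finset.card_ne_zero]
      rcases le_total (f (v i)) 0 with h | h
      · exact ⟨i, by simp [h]⟩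
      · exact ⟨j, by simpa [hc] using mul_nonpos_of_nonpos_of_nonneg hc0 h⟩
    · obtain ⟨f, hf⟩ := exists_dualCodegree_eq v ((S.erase j).erase i)
      -- A minimiser `f` may vanish on the pair and count both elements. A generic `g` separates
      -- them without enlarging the closed negative side.
      obtain ⟨g, hg, hfg⟩ := exists_generic_pos v S f
      have h1 : #{k ∈ (S.erase j).erase i | g (v k) ≤ 0} ≤
          #{k ∈ (S.erase j).erase i | f (v k) ≤ 0} := by
        refine card_le_card fun k hk => ?_
        simp only [mem_filter, Finset.mem_erase] at hk ⊢
        exact ⟨hk.1, not_lt.1 fun h => absurd (hfg k hk.1.2.2 h) (not_lt.2 hk.2)⟩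
      have h2 := dualCodegree_le v S g
      have hgi := hg i hi (hz i hi)
      have h3 : #{k ∈ S | g (v k) ≤ 0} ≤ #{k ∈ (S.erase j).erase i | g (v k) ≤ 0} + 1 := by
        rcases lt_or_gt_of_ne hgi with h | h
        · have hgj : ¬ g (v j) ≤ 0 := by
            rw [hc, map_smul, smul_eq_mul, not_le]; exact mul_pos_of_neg_of_neg hc' h
          have : ({k ∈ S | g (v k) ≤ 0} : Finset ι) = {k ∈ S.erase j | g (v k) ≤ 0} := by
            rw [Finset.filter_erase, Finset.erase_eq_of_notMem]
            simp [hgj]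
          rw [this]
          exact card_filter_erase_add_one i
        · have : ({k ∈ (S.erase j).erase i | g (v k) ≤ 0} : Finset ι) =
              {k ∈ S.erase j | g (v k) ≤ 0} := by
            rw [Finset.filter_erase, Finset.erase_eq_of_notMem]
            simp [h]
          rw [this]
          exact card_filter_erase_add_one j
      omega
    · have h1 : spanRank v S ≤ spanRank v ((S.erase j).erase i) + 1 := by
        have hle : Submodule.span ℝ (v '' S) ≤
            Submodule.span ℝ (v '' ((S.erase j).erase i)) ⊔ Submodule.span ℝ {v i} := by
          refine Submodule.span_le.2 ?_
          rintro _ ⟨k, hk, rfl⟩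
          by_cases hki : k = i
          · rw [hki]
            exact Submodule.mem_sup_right (Submodule.mem_span_singleton_self _)
          by_cases hkj : k = j
          · rw [hkj, hc]
            exact Submodule.mem_sup_right
              (Submodule.smul_mem _ _ (Submodule.mem_span_singleton_self _))
          · exact Submodule.mem_sup_left
              (Submodule.subset_span ⟨k, by simpa [hki, hkj] using hk, rfl⟩)
        have f0 := FiniteDimensional.span_of_finite ℝ (Set.toFinite {v i})
        have h2 := Submodule.finrank_mono hle
        have h3 := Submodule.finrank_add_le_finrank_add_finrank
          (Submodule.span ℝ (v '' ((S.erase j).erase i))) (Submodule.span ℝ {v i})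
        rw [finrank_span_singleton (K := ℝ) (hz i hi)] at h3
        exact h2.trans h3
      have h2 := Finset.card_erase_add_one hj
      have h3 := Finset.card_erase_add_one hiS
      omega

/-! ### Dual degree, discrepancy and the conclusion -/

lemma card_pos_le_sSup [Fintype ι] (v : ι → E) (f : Module.Dual ℝ E) :
    #{i | 0 < f (v i)} ≤ sSup (Set.range fun f : Module.Dual ℝ E => #{i | 0 < f (v i)}) :=
  le_csSup ⟨Fintype.card ι, by rintro _ ⟨g, rfl⟩; exact card_le_univ _⟩ ⟨f, rfl⟩

lemma exists_card_pos_eq_sSup [Fintype ι] (v : ι → E) : ∃ f : Module.Dual ℝ E,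
    #{i | 0 < f (v i)} = sSup (Set.range fun f : Module.Dual ℝ E => #{i | 0 < f (v i)}) :=
  Nat.sSup_mem (Set.range_nonempty _) ⟨Fintype.card ι, by rintro _ ⟨g, rfl⟩; exact card_le_univ _⟩

lemma sSup_add_dualCodegree [Fintype ι] (v : ι → E) :
    sSup (Set.range fun f : Module.Dual ℝ E => #{i | 0 < f (v i)}) + dualCodegree v univ =
      Fintype.card ι := by
  obtain ⟨f, hf⟩ := exists_card_pos_eq_sSup v
  obtain ⟨g, hg⟩ := exists_dualCodegree_eq v univ
  have h1 := card_pos_add_card_nonpos v univ f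
  have h2 := card_pos_add_card_nonpos v univ g
  have h3 := card_pos_le_sSup v g
  have h4 := dualCodegree_le v univ f
  rw [card_univ] at h1 h2
  omega

/-- The covector discrepancy is the maximal absolute value of a sign sum. -/
lemma disc_eq [Fintype ι] (v : ι → E) :
    disc v = sSup (Set.range fun f : Module.Dual ℝ E => (signSum v univ f).natAbs) := by
  rw [disc, covectors, ← Set.range_comp]
  congr 2
  ext f
  simp only [Function.comp_apply, sign_eq_one_iff, sign_eq_neg_one_iff, signSum_eq]

lemma natAbs_signSum_le_card [Fintype ι] (v : ι → E) (f : Module.Dual ℝ E) :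
    (signSum v univ f).natAbs ≤ Fintype.card ι := by
  have h1 := card_pos_add_card_nonpos v univ f
  have h2 := signSum_eq v univ f
  have h3 := card_neg_le_card_nonpos v univ f
  rw [card_univ] at h1
  omega

/-- The covector discrepancy in terms of the dual codegree. -/
lemma disc_add [Fintype ι] (v : ι → E) [DecidablePred (v · = 0)] :
    disc v + 2 * dualCodegree v univ = Fintype.card ι + #{i | v i = 0} := by
  have hbdd : BddAbove (Set.range fun f : Module.Dual ℝ E => (signSum v univ f).natAbs) :=
    ⟨Fintype.card ι, by rintro _ ⟨g, rfl⟩; exact natAbs_signSum_le_card v g⟩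
  apply le_antisymm
  · obtain ⟨f, hf⟩ := Nat.sSup_mem (Set.range_nonempty _) hbdd
    rw [← disc_eq] at hf
    -- For generic `g`, zero vectors count in the closed negative side but not in the sign sum, so
    -- the latter is `n + k - 2 * #{g ≤ 0}`.
    have key : ∀ f, signSum v univ f + 2 * dualCodegree v univ ≤
        Fintype.card ι + #{i | v i = 0} := by
      intro f
      obtain ⟨g, hg, hfg⟩ := exists_generic_signSum v univ f
      have h1 := card_pos_add_card_nonpos v univ g
      have h2 := signSum_eq v univ g
      have h3 := card_nonpos_eq hg
      have h4 := dualCodegree_le v univ g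
      rw [card_univ] at h1
      omega
    have h1 := key f
    have h2 := key (-f)
    rw [signSum_neg] at h2
    simp only at hf
    omega
  · obtain ⟨f, hf⟩ := exists_dualCodegree_eq v univ
    obtain ⟨g, hg, hfg⟩ := exists_generic_pos v univ f
    have h0 : #{k | g (v k) ≤ 0} ≤ #{k | f (v k) ≤ 0} := by
      refine card_le_card fun k hk => ?_
      simp only [mem_filter, mem_univ, true_and] at hk ⊢
      exact not_lt.1 fun h => absurd (hfg k (mem_univ k) h) (not_lt.2 hk)
    have h1 := card_pos_add_card_nonpos v univ g
    have h2 := signSum_eq v univ g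
    have h3 := card_nonpos_eq hg
    have h4 : (signSum v univ g).natAbs ≤ disc v := by
      rw [disc_eq]; exact le_csSup hbdd ⟨g, rfl⟩
    rw [card_univ] at h1
    omega

/-- A packing is completed to a codegree decomposition by the elements that it leaves out. -/
lemma IsPacking.isCodegreeStarDecomposition [Fintype ι] [DecidableEq ι] {v : ι → E} {m : ℕ}
    {P : Fin m → Finset ι} (h : IsPacking v univ P) : IsCodegreeStarDecomposition v m
      (Fin.cons (univ \ univ.biUnion P) P : Fin (m + 1) → Finset ι) := by
  constructor
  · have hP : ∀ i, Disjoint (univ \ univ.biUnion P) (P i) := fun i =>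
      Finset.sdiff_disjoint.mono_right (subset_biUnion_of_mem P (mem_univ i))
    refine Fin.cases (Fin.cases (by simp) fun j _ => hP j) fun i => Fin.cases
      (fun _ => (hP i).symm) fun j hij => ?_
    exact h.disjoint i j fun e => hij (by rw [e])
  · ext x
    simp only [mem_biUnion, mem_univ, true_and, iff_true, Fin.exists_fin_succ, Fin.cons_zero,
      Fin.cons_succ, mem_sdiff]
    tauto
  · simpa using le_antisymm h.le_sum (sum_dualCodegree_le h.subset h.disjoint)
  · simpa using h.one_le

end VectorConfig

theorem mainTheorem2 (r n : ℕ) (d δ : ℤ) (v : Fin n → Fin r → ℝ)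
    (hrank : VectorConfig.rank v = r) (hn : (n : ℤ) = r + d + 1)
    (hδ : VectorConfig.dualDegree v = δ) (hr : r ≤ 4) :
    d + 1 - 2 * δ =
        (r : ℤ) - (VectorConfig.disc v : ℤ) + ((Finset.univ.filter fun i => v i = 0).card : ℤ) ∧
      ∃ (m : ℕ) (P : Fin (m + 1) → Finset (Fin n)),
        VectorConfig.IsCodegreeStarDecomposition v m P ∧ d + 1 - 2 * δ ≤ (m : ℤ) := by
  have h1 := VectorConfig.sSup_add_dualCodegree v
  have h2 := VectorConfig.disc_add v
  have h3 : VectorConfig.spanRank v univ = r := by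
    rw [VectorConfig.rank, ← Set.image_univ, ← coe_univ] at hrank
    exact hrank
  rw [VectorConfig.dualDegree, hrank] at hδ
  rw [Fintype.card_fin] at h1 h2
  refine ⟨by omega, ?_⟩
  obtain ⟨m, P, hP, hm⟩ := VectorConfig.exists_packing v univ (h3.trans_le hr)
  refine ⟨m, _, hP.isCodegreeStarDecomposition, ?_⟩
  rw [card_univ, Fintype.card_fin, h3] at hm
  omega
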